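/- **Setting.** Fix $m\ge 1$, a non-empty set $\mathcal X\subseteq\mathbb R^d$ of alternatives and a measurable set $\Theta\subseteq\mathbb R^d$. A random vector $\boldsymbol\theta$ (the linear classifier) has a prior law $\mu$ with $\mu(\Theta)=1$, a Lebesgue density, and finite differential entropy $H(\boldsymbol\theta)=-\int_\Theta p\log_2 p$. A question is a tuple $X=(x^{(1)},\dots,x^{(m)})\in\mathcal X^m$; its true response is $Z(X)=\min\operatorname{argmax}_i\boldsymbol\theta^Tx^{(i)}$, and $A^{(z)}(X)=\{\theta\in\Theta:\theta^Tx^{(z)}\ge\theta^Tx^{(i)}\ \forall i>z,\ \theta^Tx^{(z)}>\theta^Tx^{(i)}\ \forall i<z\}$. The noise channel $f=(f^{(1)},\dots,f^{(m)})$ consists of probability densities with finite entropies $H(f^{(z)})=-\int f^{(z)}\log_2 f^{(z)}\,d\nu$, relative to a $\sigma$-finite measure $\nu$ on a measurable space of signals (e.g. Lebesgue or counting measure). At each epoch $k=1,2,\dots$ a (possibly randomized) policy $\pi$ draws a question $X_k$ using only the history $(X_\ell,Y_\ell)_{\ell<k}$ of past questions and signals; the signal $Y_k$ then has density $f^{(Z(X_k))}$,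 conditionally on $\boldsymbol\theta$, the history and $X_k$. Let $\mu_k$ be the conditional law of $\boldsymbol\theta$ given the history before epoch $k$, let $u_k(X)=\big(\mu_k(A^{(z)}(X))\big)_{z}$, and let $H^\pi_K$ be the conditional differential entropy of $\boldsymbol\theta$ given $(X_\ell,Y_\ell)_{\ell\le K}$, i.e. the expectation of the entropy of $\mu_{K+1}$. On the probability simplex $\Delta^m$ put $$\varphi(u;f)=H\Big(\sum_z u^{(z)}f^{(z)}\Big)-\sum_z u^{(z)}H(f^{(z)}),\qquad C(f)=\sup_{u\in\Delta^m}\varphi(u;f).$$ A $u\in\Delta^m$ with $\varphi(u;f)=C(f)$ is called capacity-achieving. A policy follows *entropy pursuit* in the first $K$ epochs if almost surely, for each $k\le K$, $X_k$ maximizes over all $X\in\mathcal X^m$ the one-step information gain $I_k(\boldsymbol\theta;Y_k(X))=H(\mu_k)-H_k(\boldsymbol\theta\mid Y_k(X))$, computed with $\boldsymbol\theta\sim\mu_k$. **Statement.** The supremum $C(f)$ is finite and is attained on $\Delta^m$. Moreover, for every $K\ge 0$: 1. For every policy $\pi$ the entropy of $\mu_{K+1}$ and $\sum_{k\le K}\varphi(u_k(X_k);f)$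 are integrable, and $$H(\boldsymbol\theta)-H^\pi_K=\mathbb E^\pi\Big[\sum_{k=1}^K\varphi(u_k(X_k);f)\Big].$$ 2. $H^\pi_K\ge H(\boldsymbol\theta)-K\,C(f)$ for every $\pi$; hence $\inf_\pi H^\pi_K\ge H(\boldsymbol\theta)-K\,C(f)$. 3. A policy $\pi$ satisfies $H^\pi_K=H(\boldsymbol\theta)-K\,C(f)$ if and only if almost surely $u_k(X_k)$ is capacity-achieving for every $k\le K$. In particular, if there is exactly one capacity-achieving $u_*$, this holds if and only if almost surely $u_k(X_k)=u_*$ for every $k\le K$. 4. Let $\pi$ follow entropy pursuit in the first $K$ epochs, and suppose that almost surely, for each $k\le K$, there is some $X\in\mathcal X^m$ for which $u_k(X)$ is capacity-achieving. Then $H^\pi_K=H(\boldsymbol\theta)-K\,C(f)$, and $H^\pi_K\le H^{\pi'}_K$ for every policy $\pi'$. -/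

import Mathlib

open MeasureTheory ProbabilityTheory Set

noncomputable section

namespace Preference

/-- The space `ℝ^d` of feature vectors and of linear classifiers. -/
abbrev Vec (d : ℕ) : Type := EuclideanSpace ℝ (Fin d)

/-- A comparative question: an `m`-tuple of alternatives from the set `S`. -/
abbrev Question {d : ℕ} (S : Set (Vec d)) (m : ℕ) : Type := Fin m → S

/-- What has been seen in the first `k` epochs: the questions posed and the signals observed. -/
abbrev History {d : ℕ} (S : Set (Vec d)) (m : ℕ) (Y : Type*) (k : ℕ) : Type _ :=
  Fin k → Question S m × Y

section Model

variable {d m : ℕ} {S : Set (Vec d)}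

lemma argmax_nonempty [NeZero m] (X : Question S m) (θ : Vec d) :
    (Finset.univ.filter fun i : Fin m =>
      ∀ j, inner ℝ θ (X j : Vec d) ≤ inner ℝ θ (X i : Vec d)).Nonempty := by
  obtain ⟨i, -, hi⟩ := Finset.exists_max_image (Finset.univ : Finset (Fin m))
    (fun i => inner ℝ θ (X i : Vec d)) ⟨0, Finset.mem_univ _⟩
  exact ⟨i, by simpa using fun j => hi j (Finset.mem_univ j)⟩

/-- The model-consistent response `Z(X) = min argmax_i θᵀ x⁽ⁱ⁾`. -/
def trueResponse [NeZero m] (X : Question S m) (θ : Vec d) : Fin m :=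
  (Finset.univ.filter fun i : Fin m =>
    ∀ j, inner ℝ θ (X j : Vec d) ≤ inner ℝ θ (X i : Vec d)).min' (argmax_nonempty X θ)

/-- The set `A⁽ᶻ⁾(X)` of classifiers in `Θ` that are consistent with the true response `z`. -/
def consistentSet (Θ : Set (Vec d)) (X : Question S m) (z : Fin m) : Set (Vec d) :=
  {θ ∈ Θ | (∀ i, z < i → inner ℝ θ (X i : Vec d) ≤ inner ℝ θ (X z : Vec d)) ∧
    ∀ i, i < z → inner ℝ θ (X i : Vec d) < inner ℝ θ (X z : Vec d)}

lemma trueResponse_eq_iff [NeZero m] (X : Question S m) (θ : Vec d) (z : Fin m) :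
    trueResponse X θ = z ↔
      (∀ i, z < i → inner ℝ θ (X i : Vec d) ≤ inner ℝ θ (X z : Vec d)) ∧
        ∀ i, i < z → inner ℝ θ (X i : Vec d) < inner ℝ θ (X z : Vec d) := by
  constructor
  · rintro rfl
    have h := Finset.min'_mem _ (argmax_nonempty X θ)
    rw [Finset.mem_filter] at h
    refine ⟨fun i _ => h.2 i, fun i hi => lt_of_not_ge fun hle => ?_⟩
    exact absurd (Finset.min'_le _ i (Finset.mem_filter.2
      ⟨Finset.mem_univ i, fun j => (h.2 j).trans hle⟩)) (not_le.2 hi)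
  · rintro ⟨h1, h2⟩
    have hz : ∀ j, inner ℝ θ (X j : Vec d) ≤ inner ℝ θ (X z : Vec d) := fun j => by
      rcases lt_trichotomy j z with h | h | h
      · exact (h2 j h).le
      · rw [h]
      · exact h1 j h
    refine le_antisymm (Finset.min'_le _ _ (Finset.mem_filter.2 ⟨Finset.mem_univ z, hz⟩)) ?_
    refine Finset.le_min' _ _ _ fun i hi => le_of_not_gt fun hlt => ?_
    exact absurd ((Finset.mem_filter.1 hi).2 z) (not_le.2 (h2 i hlt))

lemma measurable_trueResponse [NeZero m] :
    Measurable fun p : Vec d × Question S m => trueResponse p.2 p.1 := by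
  have hin : ∀ i : Fin m, Measurable fun p : Vec d × Question S m =>
      inner ℝ p.1 (p.2 i : Vec d) := fun i =>
    measurable_fst.inner (measurable_subtype_coe.comp ((measurable_pi_apply i).comp measurable_snd))
  refine measurable_to_countable' fun z => ?_
  have : (fun p : Vec d × Question S m => trueResponse p.2 p.1) ⁻¹' {z} =
      (⋂ i, ⋂ _ : z < i, {p | inner ℝ p.1 (p.2 i : Vec d) ≤ inner ℝ p.1 (p.2 z : Vec d)}) ∩
        ⋂ i, ⋂ _ : i < z, {p | inner ℝ p.1 (p.2 i : Vec d) < inner ℝ p.1 (p.2 z : Vec d)} := by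
    ext p
    simp [trueResponse_eq_iff]
  rw [this]
  exact (MeasurableSet.iInter fun i => MeasurableSet.iInter fun _ =>
    measurableSet_le (hin i) (hin z)).inter (MeasurableSet.iInter fun i =>
      MeasurableSet.iInter fun _ => measurableSet_lt (hin i) (hin z))

/-- The predictive distribution `u(X)`, `u⁽ᶻ⁾(X) = μ(A⁽ᶻ⁾(X))`, under the belief `μ`. -/
def predictive (Θ : Set (Vec d)) (μ : Measure (Vec d)) (X : Question S m) : Fin m → ℝ :=
  fun z => μ.real (consistentSet Θ X z)

end Model

/-- A noise channel: probability densities `f⁽ᶻ⁾` with respect to a reference measure `ν` on the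
signal space (Lebesgue measure, or counting measure for a discrete channel). -/
structure NoiseChannel (m : ℕ) {Y : Type*} [MeasurableSpace Y] (ν : Measure Y) where
  f : Fin m → Y → ℝ
  measurable_f : ∀ z, Measurable (f z)
  nonneg : ∀ z y, 0 ≤ f z y
  lintegral_eq_one : ∀ z, ∫⁻ y, ENNReal.ofReal (f z y) ∂ν = 1

/-- The entropy, in bits, of a density `g` with respect to `ν`. -/
def densityEntropy {α : Type*} [MeasurableSpace α] (ν : Measure α) (g : α → ℝ) : ℝ :=
  ∫ a, -(g a * Real.logb 2 (g a)) ∂ν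

/-- The Lebesgue density of a measure on `ℝ^d`. -/
def lebesgueDensity {d : ℕ} (μ : Measure (Vec d)) : Vec d → ℝ :=
  fun θ => (μ.rnDeriv volume θ).toReal

/-- The differential entropy, in bits, of an absolutely continuous measure `μ` on `Θ`. -/
def diffEntropy {d : ℕ} (Θ : Set (Vec d)) (μ : Measure (Vec d)) : ℝ :=
  densityEntropy (volume.restrict Θ) (lebesgueDensity μ)

/-- For a joint law `ρ` of `(θ, s)`: the entropy of the conditional law of `θ` given `s`. -/
def posteriorEntropy {d : ℕ} (Θ : Set (Vec d)) {T : Type*} [MeasurableSpace T]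
    (ρ : Measure (Vec d × T)) [IsFiniteMeasure ρ] (s : T) : ℝ :=
  diffEntropy Θ (condDistrib Prod.fst Prod.snd ρ s)

/-- For a joint law `ρ` of `(θ, s)`: the conditional differential entropy `H(θ | s)`. -/
def condEntropy {d : ℕ} (Θ : Set (Vec d)) {T : Type*} [MeasurableSpace T]
    (ρ : Measure (Vec d × T)) [IsFiniteMeasure ρ] : ℝ :=
  ∫ s, posteriorEntropy Θ ρ s ∂(ρ.map Prod.snd)

section Channel

variable {m : ℕ} {Y : Type*} [MeasurableSpace Y] {ν : Measure Y}

/-- `φ(u; f) = H(∑ u⁽ᶻ⁾ f⁽ᶻ⁾) - ∑ u⁽ᶻ⁾ H(f⁽ᶻ⁾)`. -/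
def NoiseChannel.phi (c : NoiseChannel m ν) (u : Fin m → ℝ) : ℝ :=
  densityEntropy ν (fun y => ∑ z, u z * c.f z y) - ∑ z, u z * densityEntropy ν (c.f z)

/-- The channel capacity `C(f)`, the supremum of `φ(·; f)` over the probability simplex. -/
def NoiseChannel.capacity (c : NoiseChannel m ν) : ℝ :=
  sSup (c.phi '' stdSimplex ℝ (Fin m))

/-- `u` is a probability vector that attains the capacity. -/
def NoiseChannel.CapacityAchieving (c : NoiseChannel m ν) (u : Fin m → ℝ) : Prop :=
  u ∈ stdSimplex ℝ (Fin m) ∧ c.phi u = c.capacity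

/-- The conditional law of the signal given the true response. -/
def NoiseChannel.kernel (c : NoiseChannel m ν) : Kernel (Fin m) Y :=
  Kernel.ofFunOfCountable fun z => ν.withDensity fun y => ENNReal.ofReal (c.f z y)

instance (c : NoiseChannel m ν) : IsMarkovKernel c.kernel :=
  ⟨fun z => ⟨by
    simp [NoiseChannel.kernel, Kernel.ofFunOfCountable, c.lintegral_eq_one z]⟩⟩

variable {d : ℕ} {S : Set (Vec d)} [NeZero m]

/-- The conditional law of the signal given the classifier and the question: it depends on them
only through the true response. -/
def NoiseChannel.signal (c : NoiseChannel m ν) (S : Set (Vec d)) :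
    Kernel (Vec d × Question S m) Y :=
  c.kernel.comap (fun p => trueResponse p.2 p.1) measurable_trueResponse

instance (c : NoiseChannel m ν) : IsMarkovKernel (c.signal S) := by
  unfold NoiseChannel.signal; infer_instance

/-- The joint law of the classifier, with belief `μ`, and of the signal in answer to `X`. -/
def oneStepLaw (c : NoiseChannel m ν) (μ : Measure (Vec d)) (X : Question S m) :
    Measure (Vec d × Y) :=
  μ ⊗ₘ (c.signal S).comap (fun θ => (θ, X)) measurable_prodMk_right

instance (c : NoiseChannel m ν) (μ : Measure (Vec d)) [IsFiniteMeasure μ] (X : Question S m) :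
    IsFiniteMeasure (oneStepLaw c μ X) := by
  unfold oneStepLaw; infer_instance

/-- The mutual information `I(θ; Y(X)) = H(θ) - H(θ | Y(X))` under the belief `μ`. -/
def mutualInfo (c : NoiseChannel m ν) (Θ : Set (Vec d)) (μ : Measure (Vec d)) [IsFiniteMeasure μ]
    (X : Question S m) : ℝ :=
  diffEntropy Θ μ - condEntropy Θ (oneStepLaw c μ X)

end Channel

/-- A (possibly randomized) policy: for each epoch, the law of the next question given the past
questions and signals. Epochs are numbered from `0`. -/
structure Policy {d : ℕ} (S : Set (Vec d)) (m : ℕ) (Y : Type*) [MeasurableSpace Y] where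
  ask : (k : ℕ) → Kernel (History S m Y k) (Question S m)
  markov : ∀ k, IsMarkovKernel (ask k)

section Dynamics

variable {d m : ℕ} {S : Set (Vec d)} {Y : Type*} [MeasurableSpace Y] {ν : Measure Y}

instance (π : Policy S m Y) (k : ℕ) : IsMarkovKernel (π.ask k) := π.markov k

variable [NeZero m]

/-- One epoch: given the classifier and the history, the policy draws a question from the history
alone, and the channel answers it. -/
def epoch (c : NoiseChannel m ν) (π : Policy S m Y) (k : ℕ) :
    Kernel (Vec d × History S m Y k) (Question S m × Y) :=
  (π.ask k).comap Prod.snd measurable_snd ⊗ₖ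
    (c.signal S).comap (fun p => (p.1.1, p.2))
      ((measurable_fst.comp measurable_fst).prodMk measurable_snd)

instance (c : NoiseChannel m ν) (π : Policy S m Y) (k : ℕ) : IsMarkovKernel (epoch c π k) := by
  unfold epoch; infer_instance

/-- Append the question and signal of an epoch to the history. -/
def extend (k : ℕ) (p : (Vec d × History S m Y k) × (Question S m × Y)) :
    Vec d × History S m Y (k + 1) :=
  (p.1.1, Fin.snoc p.1.2 p.2)

lemma measurable_extend (k : ℕ) :
    Measurable (extend (d := d) (m := m) (S := S) (Y := Y) k) := by
  refine (measurable_fst.comp measurable_fst).prodMk (measurable_pi_lambda _ fun i => ?_)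
  refine Fin.lastCases ?_ (fun j => ?_) i
  · simpa using measurable_snd
  · simp only [extend, Fin.snoc_castSucc]
    exact (measurable_pi_apply j).comp (measurable_snd.comp measurable_fst)

/-- The joint law, under the policy `π` and the prior `μ`, of the classifier and of the first `k`
questions and signals. -/
def law (c : NoiseChannel m ν) (μ : Measure (Vec d)) (π : Policy S m Y) :
    (k : ℕ) → Measure (Vec d × History S m Y k)
  | 0 => μ.map fun θ => (θ, Fin.elim0)
  | k + 1 => (law c μ π k ⊗ₘ epoch c π k).map (extend k)

instance (c : NoiseChannel m ν) (μ : Measure (Vec d)) [IsProbabilityMeasure μ]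
    (π : Policy S m Y) (k : ℕ) : IsProbabilityMeasure (law c μ π k) := by
  induction k with
  | zero => exact Measure.isProbabilityMeasure_map measurable_prodMk_right.aemeasurable
  | succ k ih => exact Measure.isProbabilityMeasure_map (measurable_extend k).aemeasurable

/-- The posterior `μ_k`: the conditional law of the classifier given the first `k` questions and
signals. -/
def belief (c : NoiseChannel m ν) (μ : Measure (Vec d)) [IsProbabilityMeasure μ]
    (π : Policy S m Y) (k : ℕ) : Kernel (History S m Y k) (Vec d) :=
  condDistrib Prod.fst Prod.snd (law c μ π k)

instance (c : NoiseChannel m ν) (μ : Measure (Vec d)) [IsProbabilityMeasure μ]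
    (π : Policy S m Y) (k : ℕ) : IsMarkovKernel (belief c μ π k) := by
  unfold belief; infer_instance

/-- The history before epoch `k`, as part of a history of length `K`. -/
def past {K : ℕ} (h : History S m Y K) (k : Fin K) : History S m Y k :=
  fun i => h (Fin.castLE k.isLt.le i)

/-- `u_k(X_k)`: the predictive distribution, under the posterior before epoch `k`, of the question
posed at epoch `k`. -/
def askedPredictive (c : NoiseChannel m ν) (Θ : Set (Vec d)) (μ : Measure (Vec d))
    [IsProbabilityMeasure μ] (π : Policy S m Y) {K : ℕ} (h : History S m Y K) (k : Fin K) :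
    Fin m → ℝ :=
  predictive Θ (belief c μ π k (past h k)) (h k).1

/-- `π` follows entropy pursuit in the first `K` epochs: almost surely, each question it poses
maximizes over all questions the one-step mutual information under the current posterior. -/
def EntropyPursuit (c : NoiseChannel m ν) (Θ : Set (Vec d)) (μ : Measure (Vec d))
    [IsProbabilityMeasure μ] (π : Policy S m Y) (K : ℕ) : Prop :=
  ∀ᵐ ω ∂(law c μ π K), ∀ k : Fin K, ∀ X : Question S m,
    mutualInfo c Θ (belief c μ π k (past ω.2 k)) X ≤
      mutualInfo c Θ (belief c μ π k (past ω.2 k)) (ω.2 k).1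

end Dynamics

end Preference

end

open Preference

/-! The proof is the chain rule for mutual information, carried out on logarithms of densities.
Given the history and the question, the signal depends on the classifier only through the response,
whose law is `u = u_k(X_k)`. By Bayes' rule a signal `y` multiplies the density of the belief at `θ`
by the likelihood ratio of `y` under the response of `θ` and under the mixture of the `f⁽ᶻ⁾` with
weights `u`. So the log-density changes by the additive term `infoDensity`, whose mean given history
and question is `φ(u; f)`. The expected posterior entropy is minus the integral of the log-density
over the joint law of data and classifier; hence each epoch lowers it by the mean of `φ(u_k(X_k);
f)`, and summing over epochs gives the identity for the entropy reduction (`HasLogDensity.update`,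
`HasLogDensity.integral_update`, `condEntropy_succ`).

The rest follows from `φ ≤ C(f)`. The excess of the conditional entropy over the bound is the
integral of a sum of nonnegative shortfalls `C(f) - φ(u_k(X_k); f)`, so it vanishes exactly when
almost surely all of them do. The one-epoch computation, with a single fixed question, also
identifies the information gain with `φ` of the predictive distribution (`mutualInfo_eq_phi`); a
maximizer of the gain therefore reaches the capacity whenever some question does. The capacity is
attained because `φ` is continuous on the compact simplex. -/

noncomputable section

namespace Preference

/-! ### The function `φ` on the simplex and the capacity of the channel. -/

section Capacity

variable {m : ℕ} {Y : Type*} [MeasurableSpace Y] {ν : Measure Y}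

/-- The predictive density of the signal when the true response has distribution `u`. -/
def NoiseChannel.mix (c : NoiseChannel m ν) (u : Fin m → ℝ) (y : Y) : ℝ :=
  ∑ z, u z * c.f z y

/-- The likelihood ratio of the signal `y` under the response `z` and under the mixture `u`. -/
def NoiseChannel.ratio (c : NoiseChannel m ν) (u : Fin m → ℝ) (z : Fin m) (y : Y) : ℝ :=
  c.f z y / c.mix u y

lemma le_one_of_mem_stdSimplex {u : Fin m → ℝ} (hu : u ∈ stdSimplex ℝ (Fin m)) (z : Fin m) :
    u z ≤ 1 := by
  rw [← hu.2]
  exact Finset.single_le_sum (fun z _ => hu.1 z) (Finset.mem_univ z)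

variable (c : NoiseChannel m ν)

lemma NoiseChannel.integrable_f (z : Fin m) : Integrable (c.f z) ν := by
  refine ⟨(c.measurable_f z).aestronglyMeasurable, ?_⟩
  rw [hasFiniteIntegral_iff_ofReal (Filter.Eventually.of_forall (c.nonneg z)),
    c.lintegral_eq_one z]
  exact ENNReal.one_lt_top

lemma NoiseChannel.integral_f (z : Fin m) : ∫ y, c.f z y ∂ν = 1 := by
  rw [integral_eq_lintegral_of_nonneg_ae (Filter.Eventually.of_forall (c.nonneg z))
    (c.measurable_f z).aestronglyMeasurable, c.lintegral_eq_one z, ENNReal.toReal_one]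

lemma NoiseChannel.mix_nonneg {u : Fin m → ℝ} (hu : ∀ z, 0 ≤ u z) (y : Y) : 0 ≤ c.mix u y :=
  Finset.sum_nonneg fun z _ => mul_nonneg (hu z) (c.nonneg z y)

lemma NoiseChannel.mul_le_mix {u : Fin m → ℝ} (hu : ∀ z, 0 ≤ u z) (z : Fin m) (y : Y) :
    u z * c.f z y ≤ c.mix u y :=
  Finset.single_le_sum (f := fun z => u z * c.f z y)
    (fun z _ => mul_nonneg (hu z) (c.nonneg z y)) (Finset.mem_univ z)

lemma NoiseChannel.mix_le_sum {u : Fin m → ℝ} (hu : u ∈ stdSimplex ℝ (Fin m)) (y : Y) :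
    c.mix u y ≤ ∑ z, c.f z y := by
  exact Finset.sum_le_sum fun z _ =>
    mul_le_of_le_one_left (c.nonneg z y) (le_one_of_mem_stdSimplex hu z)

lemma NoiseChannel.integrable_mix (u : Fin m → ℝ) : Integrable (c.mix u) ν :=
  integrable_finsetSum _ fun z _ => (c.integrable_f z).const_mul (u z)

lemma NoiseChannel.integral_mix {u : Fin m → ℝ} (hu : u ∈ stdSimplex ℝ (Fin m)) :
    ∫ y, c.mix u y ∂ν = 1 := by
  simp only [NoiseChannel.mix]
  rw [integral_finsetSum _ fun z _ => (c.integrable_f z).const_mul (u z)]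
  simp [integral_const_mul, c.integral_f, hu.2]

lemma NoiseChannel.measurable_uncurry_mix :
    Measurable fun p : (Fin m → ℝ) × Y => c.mix p.1 p.2 :=
  Finset.measurable_sum _ fun z _ =>
    ((measurable_pi_apply z).comp measurable_fst).mul ((c.measurable_f z).comp measurable_snd)

lemma NoiseChannel.measurable_mix (u : Fin m → ℝ) : Measurable (c.mix u) :=
  c.measurable_uncurry_mix.comp measurable_prodMk_left

lemma NoiseChannel.measurable_ratio (u : Fin m → ℝ) (z : Fin m) : Measurable (c.ratio u z) :=
  (c.measurable_f z).div (c.measurable_mix u)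

/-- The information density is dominated by the signal densities. -/
lemma NoiseChannel.abs_mul_logb_ratio_le {u : Fin m → ℝ} (hu : u ∈ stdSimplex ℝ (Fin m))
    (z : Fin m) (y : Y) :
    |u z * (c.f z y * Real.logb 2 (c.ratio u z y))| ≤ (c.f z y + c.mix u y) / Real.log 2 := by
  have hl : 0 < Real.log 2 := Real.log_pos one_lt_two
  have hg := c.mix_nonneg hu.1 y
  have hle := c.mul_le_mix hu.1 z y
  rcases (c.nonneg z y).eq_or_lt with hf | hf
  · rw [← hf]; simp only [zero_mul, mul_zero, abs_zero, zero_add]; positivity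
  rcases (hu.1 z).eq_or_lt with hw | hw
  · rw [← hw]; simp only [zero_mul, abs_zero]; positivity
  have hgp : 0 < c.mix u y := (mul_pos hw hf).trans_le hle
  have hr : 0 < c.f z y / c.mix u y := div_pos hf hgp
  -- For `r = f/g` with `g` the mixture, `log r ≤ r` and `-log r ≤ 1/r`. Since `u f ≤ g` and `u ≤
  -- 1`, the two products with `u f` are at most `f` and `g`. The weight `u` is essential: without
  -- it the upper bound fails.
  have h1 : Real.log (c.f z y / c.mix u y) ≤ c.f z y / c.mix u y := by
    linarith [Real.log_le_sub_one_of_pos hr]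
  have h2 : -Real.log (c.f z y / c.mix u y) ≤ c.mix u y / c.f z y := by
    rw [← Real.log_inv, inv_div]
    linarith [Real.log_le_sub_one_of_pos (div_pos hgp hf)]
  have hu1 : u z * c.f z y * Real.log (c.f z y / c.mix u y) ≤ c.f z y := by
    calc _ ≤ u z * c.f z y * (c.f z y / c.mix u y) := by gcongr
      _ ≤ c.mix u y * (c.f z y / c.mix u y) := by gcongr
      _ = c.f z y := by field_simp
  have hl1 : -(u z * c.f z y * Real.log (c.f z y / c.mix u y)) ≤ c.mix u y := by
    calc _ = u z * c.f z y * -Real.log (c.f z y / c.mix u y) := by ring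
      _ ≤ u z * c.f z y * (c.mix u y / c.f z y) := by gcongr
      _ = u z * c.mix u y := by field_simp
      _ ≤ c.mix u y := mul_le_of_le_one_left hg (le_one_of_mem_stdSimplex hu z)
  have he : u z * (c.f z y * Real.logb 2 (c.ratio u z y)) =
      u z * c.f z y * Real.log (c.f z y / c.mix u y) / Real.log 2 := by
    rw [NoiseChannel.ratio, Real.logb]; ring
  rw [he, abs_div, abs_of_pos hl]
  gcongr
  rw [abs_le]
  constructor <;> linarith

lemma NoiseChannel.integrable_mul_logb_ratio {u : Fin m → ℝ} (hu : u ∈ stdSimplex ℝ (Fin m))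
    (z : Fin m) : Integrable (fun y => u z * (c.f z y * Real.logb 2 (c.ratio u z y))) ν := by
  refine Integrable.mono' (((c.integrable_f z).add (c.integrable_mix u)).div_const (Real.log 2))
    ?_ (Filter.Eventually.of_forall fun y => c.abs_mul_logb_ratio_le hu z y)
  have := c.measurable_f z
  have := c.measurable_ratio u z
  unfold Real.logb
  fun_prop

/-- The logarithm of a quotient splits only when neither term vanishes. If `f` or the weight is
zero, every term is zero; otherwise the mixture is at least `u f > 0`. -/
lemma NoiseChannel.mul_logb_ratio_eq {u : Fin m → ℝ} (hu : u ∈ stdSimplex ℝ (Fin m))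
    (z : Fin m) (y : Y) :
    u z * (c.f z y * Real.logb 2 (c.ratio u z y)) =
      u z * (c.f z y * Real.logb 2 (c.f z y)) - u z * c.f z y * Real.logb 2 (c.mix u y) := by
  rcases (c.nonneg z y).eq_or_lt with hf | hf
  · simp [← hf]
  rcases (hu.1 z).eq_or_lt with hw | hw
  · simp [← hw]
  have hgp : 0 < c.mix u y := (mul_pos hw hf).trans_le (c.mul_le_mix hu.1 z y)
  rw [NoiseChannel.ratio, Real.logb_div hf.ne' hgp.ne']
  ring

/-- Splits the entropy integrand of the mixture into parts that are dominated uniformly in `u`.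
Integration gives `phi_eq`, and the domination gives continuity of `φ`. -/
lemma NoiseChannel.mix_mul_logb_mix {u : Fin m → ℝ} (hu : u ∈ stdSimplex ℝ (Fin m)) (y : Y) :
    c.mix u y * Real.logb 2 (c.mix u y) =
      ∑ z, u z * (c.f z y * Real.logb 2 (c.f z y)) -
        ∑ z, u z * (c.f z y * Real.logb 2 (c.ratio u z y)) := by
  rw [← Finset.sum_sub_distrib]
  nth_rewrite 1 [NoiseChannel.mix]
  rw [Finset.sum_mul]
  refine Finset.sum_congr rfl fun z _ => ?_
  rw [c.mul_logb_ratio_eq hu]; ring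

/-- `φ(u; f)` is the mutual information of the response and the signal. -/
lemma NoiseChannel.phi_eq (hc : ∀ z, Integrable (fun y => c.f z y * Real.logb 2 (c.f z y)) ν)
    {u : Fin m → ℝ} (hu : u ∈ stdSimplex ℝ (Fin m)) :
    c.phi u = ∑ z, u z * ∫ y, c.f z y * Real.logb 2 (c.ratio u z y) ∂ν := by
  have h1 : densityEntropy ν (fun y => ∑ z, u z * c.f z y) =
      -∫ y, c.mix u y * Real.logb 2 (c.mix u y) ∂ν := integral_neg _
  have h2 : ∀ z, densityEntropy ν (c.f z) = -∫ y, c.f z y * Real.logb 2 (c.f z y) ∂ν :=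
    fun z => integral_neg _
  simp_rw [NoiseChannel.phi, h1, h2, c.mix_mul_logb_mix hu]
  rw [integral_sub (integrable_finsetSum _ fun z _ => (hc z).const_mul _)
    (integrable_finsetSum _ fun z _ => c.integrable_mul_logb_ratio hu z),
    integral_finsetSum _ fun z _ => (hc z).const_mul _,
    integral_finsetSum _ fun z _ => c.integrable_mul_logb_ratio hu z]
  simp [integral_const_mul]

/-- Dominated convergence: `t log t` is continuous, also at zero, and the bound for the mixture
integrand does not depend on `u`. -/
lemma NoiseChannel.continuousOn_phi
    (hc : ∀ z, Integrable (fun y => c.f z y * Real.logb 2 (c.f z y)) ν) :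
    ContinuousOn c.phi (stdSimplex ℝ (Fin m)) := by
  unfold NoiseChannel.phi densityEntropy
  refine ContinuousOn.sub ?_ (by fun_prop)
  refine continuousOn_of_dominated (bound := fun y =>
    ∑ z, |c.f z y * Real.logb 2 (c.f z y)| + ∑ z, (c.f z y + ∑ i, c.f i y) / Real.log 2)
    (fun u hu => ?_) (fun u hu => Filter.Eventually.of_forall fun y => ?_) ?_
    (Filter.Eventually.of_forall fun y => Continuous.continuousOn ?_)
  · have := c.measurable_mix u
    unfold NoiseChannel.mix at this
    unfold Real.logb
    fun_prop
  · change ‖-(c.mix u y * Real.logb 2 (c.mix u y))‖ ≤ _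
    rw [norm_neg, c.mix_mul_logb_mix hu, Real.norm_eq_abs]
    refine (abs_sub _ _).trans (add_le_add ?_ ?_)
    · refine (Finset.abs_sum_le_sum_abs _ _).trans (Finset.sum_le_sum fun z _ => ?_)
      rw [abs_mul, abs_of_nonneg (hu.1 z)]
      exact mul_le_of_le_one_left (abs_nonneg _) (le_one_of_mem_stdSimplex hu z)
    · refine (Finset.abs_sum_le_sum_abs _ _).trans (Finset.sum_le_sum fun z _ => ?_)
      refine (c.abs_mul_logb_ratio_le hu z y).trans ?_
      have hl : 0 < Real.log 2 := Real.log_pos one_lt_two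
      gcongr
      exact c.mix_le_sum hu y
  · refine (integrable_finsetSum _ fun z _ => (hc z).abs).add
      (integrable_finsetSum _ fun z _ => ((c.integrable_f z).add
        (integrable_finsetSum _ fun i _ => c.integrable_f i)).div_const _)
  · have h : Continuous fun u : Fin m → ℝ => ∑ z, u z * c.f z y := by fun_prop
    simp_rw [Real.logb, ← mul_div_assoc]
    exact ((Real.continuous_mul_log.comp h).div_const _).neg

/-- The capacity is attained. -/
lemma NoiseChannel.isGreatest_capacity [NeZero m]
    (hc : ∀ z, Integrable (fun y => c.f z y * Real.logb 2 (c.f z y)) ν) :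
    IsGreatest (c.phi '' stdSimplex ℝ (Fin m)) c.capacity :=
  ((isCompact_stdSimplex ℝ (Fin m)).image_of_continuousOn (c.continuousOn_phi hc)).isGreatest_sSup
    (Set.Nonempty.image _ ⟨_, single_mem_stdSimplex ℝ (0 : Fin m)⟩)

end Capacity

lemma integrable_integral_of_compProd {α γ : Type*} [MeasurableSpace α] [MeasurableSpace γ]
    {μ : Measure α} [SFinite μ] {κ : Kernel α γ} [IsSFiniteKernel κ] {f : α × γ → ℝ}
    (hf : Integrable f (μ ⊗ₘ κ)) : Integrable (fun a => ∫ b, f (a, b) ∂(κ a)) μ :=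
  Integrable.integral_compProd hf

/-! ### Bayes' rule for one signal, and the information density. -/

section Bayes

open scoped ENNReal

variable {m : ℕ} {E T Y : Type*} [MeasurableSpace E] [MeasurableSpace T] [MeasurableSpace Y]
  {ν : Measure Y}

/-- The law of the response `Z (t, ·)` under the belief `β t`. -/
def responseLaw (β : Kernel T E) (Z : T × E → Fin m) (t : T) : Fin m → ℝ :=
  fun z => (β t).real {x | Z (t, x) = z}

lemma responseLaw_nonneg (β : Kernel T E) (Z : T × E → Fin m) (t : T) (z : Fin m) :
    0 ≤ responseLaw β Z t z := measureReal_nonneg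

section ResponseLaw

variable {β : Kernel T E} [IsMarkovKernel β] {Z : T × E → Fin m} (hZ : Measurable Z)

include hZ

lemma measurable_responseLaw : Measurable (responseLaw β Z) :=
  measurable_pi_lambda _ fun z =>
    (Kernel.measurable_kernel_prodMk_left (κ := β) (hZ (measurableSet_singleton z))).ennreal_toReal

lemma integral_response (t : T) (φ : Fin m → ℝ) :
    ∫ x, φ (Z (t, x)) ∂(β t) = ∑ z, responseLaw β Z t z * φ z := by
  have h : Measurable fun x => Z (t, x) := hZ.comp measurable_prodMk_left
  rw [← integral_map (φ := fun x => Z (t, x)) (f := φ) h.aemeasurable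
    (measurable_of_finite φ).aestronglyMeasurable,
    integral_fintype (Integrable.of_finite)]
  refine Finset.sum_congr rfl fun z _ => ?_
  rw [map_measureReal_apply h (measurableSet_singleton z)]
  rfl

lemma lintegral_response (t : T) (φ : Fin m → ℝ≥0∞) :
    ∫⁻ x, φ (Z (t, x)) ∂(β t) = ∑ z, ENNReal.ofReal (responseLaw β Z t z) * φ z := by
  have h : Measurable fun x => Z (t, x) := hZ.comp measurable_prodMk_left
  rw [← lintegral_map (g := fun x => Z (t, x)) (f := φ) (measurable_of_finite φ) h,
    lintegral_fintype]
  refine Finset.sum_congr rfl fun z _ => ?_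
  rw [Measure.map_apply h (measurableSet_singleton z), responseLaw, ofReal_measureReal, mul_comm]
  rfl

lemma responseLaw_mem_stdSimplex (t : T) : responseLaw β Z t ∈ stdSimplex ℝ (Fin m) := by
  refine ⟨fun z => measureReal_nonneg, ?_⟩
  simpa using (integral_response (β := β) hZ t fun _ => 1).symm

end ResponseLaw

/-- The joint law of a parameter, of a latent variable with conditional law `β`, and of the signal
in answer to the response `Z`. -/
def signalLaw (c : NoiseChannel m ν) (τ : Measure T) (β : Kernel T E) (Z : T × E → Fin m)
    (hZ : Measurable Z) : Measure ((T × E) × Y) :=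
  (τ ⊗ₘ β) ⊗ₘ c.kernel.comap Z hZ

/-- The density of the updated belief, on seeing a signal, with respect to the belief. -/
def bayesFactor (c : NoiseChannel m ν) (β : Kernel T E) (Z : T × E → Fin m) (p : T × Y) (x : E) :
    ℝ :=
  if c.mix (responseLaw β Z p.1) p.2 = 0 then 1
  else c.ratio (responseLaw β Z p.1) (Z (p.1, x)) p.2

/-- The updated belief, on seeing a signal. -/
def bayesUpdate (c : NoiseChannel m ν) (β : Kernel T E) [IsMarkovKernel β] (Z : T × E → Fin m) :
    Kernel (T × Y) E :=
  (β.prodMkRight Y).withDensity fun p x => ENNReal.ofReal (bayesFactor c β Z p x)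

/-- The information density of the response and the signal, given the parameter. -/
def infoDensity (c : NoiseChannel m ν) (β : Kernel T E) (Z : T × E → Fin m) (p : (T × E) × Y) : ℝ :=
  Real.logb 2 (c.ratio (responseLaw β Z p.1.1) (Z p.1) p.2)

variable (c : NoiseChannel m ν) {τ : Measure T} {β : Kernel T E} {Z : T × E → Fin m}

lemma NoiseChannel.ratio_nonneg {u : Fin m → ℝ} (hu : ∀ z, 0 ≤ u z) (z : Fin m) (y : Y) :
    0 ≤ c.ratio u z y :=
  div_nonneg (c.nonneg z y) (c.mix_nonneg hu y)

lemma bayesFactor_nonneg (p : T × Y) (x : E) : 0 ≤ bayesFactor c β Z p x := by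
  unfold bayesFactor
  split_ifs
  · exact zero_le_one
  · exact c.ratio_nonneg (responseLaw_nonneg β Z _) _ _

/-- No exceptional set is needed: where the mixture vanishes, the factor is `1`, with logarithm
zero, while the ratio is a division by zero, hence `0`, whose logarithm is zero by convention. -/
lemma logb_bayesFactor (p : T × Y) (x : E) :
    Real.logb 2 (bayesFactor c β Z p x) = infoDensity c β Z ((p.1, x), p.2) := by
  unfold bayesFactor infoDensity NoiseChannel.ratio
  split_ifs with h <;> simp [h]

variable [IsMarkovKernel β] (hZ : Measurable Z)

lemma NoiseChannel.kernel_apply (z : Fin m) :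
    c.kernel z = ν.withDensity fun y => ENNReal.ofReal (c.f z y) := rfl

lemma NoiseChannel.measurable_uncurry_f : Measurable fun p : Fin m × Y => c.f p.1 p.2 :=
  measurable_from_prod_countable_right c.measurable_f

include hZ in
lemma measurable_bayesRatio : Measurable fun q : (T × Y) × E =>
    c.ratio (responseLaw β Z q.1.1) (Z (q.1.1, q.2)) q.1.2 := by
  have h1 : Measurable fun q : (T × Y) × E => Z (q.1.1, q.2) := hZ.comp (by fun_prop)
  have h2 := measurable_responseLaw (β := β) hZ
  refine (c.measurable_uncurry_f.comp (h1.prodMk (measurable_snd.comp measurable_fst))).div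
    (c.measurable_uncurry_mix.comp
      (f := fun q : (T × Y) × E => (responseLaw β Z q.1.1, q.1.2)) ?_)
  fun_prop

include hZ in
lemma measurable_bayesFactor : Measurable (Function.uncurry (bayesFactor c β Z)) := by
  have h2 := measurable_responseLaw (β := β) hZ
  refine Measurable.ite ?_ measurable_const (measurable_bayesRatio c hZ)
  have h3 : Measurable fun q : (T × Y) × E => c.mix (responseLaw β Z q.1.1) q.1.2 :=
    c.measurable_uncurry_mix.comp
      (f := fun q : (T × Y) × E => (responseLaw β Z q.1.1, q.1.2)) (by fun_prop)
  exact h3 (measurableSet_singleton 0)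

include hZ in
lemma measurable_infoDensity : Measurable (infoDensity c β Z) := by
  have h := (measurable_bayesRatio c (β := β) hZ).comp
    (show Measurable fun p : (T × E) × Y => ((p.1.1, p.2), p.1.2) by fun_prop)
  exact (Real.measurable_log.comp h).div_const _

include hZ in
lemma bayesUpdate_apply (p : T × Y) : bayesUpdate c β Z p =
    (β p.1).withDensity fun x => ENNReal.ofReal (bayesFactor c β Z p x) := by
  rw [bayesUpdate, Kernel.withDensity_apply _ (measurable_bayesFactor c hZ).ennreal_ofReal]
  rfl

include hZ in
/-- The marginal density of the signal. -/
lemma lintegral_f_response (t : T) (y : Y) :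
    ∫⁻ x, ENNReal.ofReal (c.f (Z (t, x)) y) ∂(β t) =
      ENNReal.ofReal (c.mix (responseLaw β Z t) y) := by
  rw [lintegral_response hZ t fun z => ENNReal.ofReal (c.f z y), NoiseChannel.mix,
    ENNReal.ofReal_sum_of_nonneg fun z _ =>
      mul_nonneg (responseLaw_nonneg β Z t z) (c.nonneg z y)]
  exact Finset.sum_congr rfl fun z _ => (ENNReal.ofReal_mul measureReal_nonneg).symm

include hZ in
/-- Bayes' rule for the integral of a test function. -/
lemma mix_mul_lintegral_bayesFactor (t : T) (y : Y) {φ : E → ℝ≥0∞} (hφ : Measurable φ) :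
    ENNReal.ofReal (c.mix (responseLaw β Z t) y) *
        ∫⁻ x, ENNReal.ofReal (bayesFactor c β Z (t, y) x) * φ x ∂(β t) =
      ∫⁻ x, ENNReal.ofReal (c.f (Z (t, x)) y) * φ x ∂(β t) := by
  have hZt : Measurable fun x => Z (t, x) := hZ.comp measurable_prodMk_left
  have hf : Measurable fun x => ENNReal.ofReal (c.f (Z (t, x)) y) :=
    (measurable_of_finite fun z => ENNReal.ofReal (c.f z y)).comp hZt
  -- A signal of marginal density zero has `f` equal to zero for almost every `x` under the belief,
  -- so both sides vanish.
  by_cases h : c.mix (responseLaw β Z t) y = 0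
  · have h0 := lintegral_f_response c (β := β) hZ t y
    rw [h, ENNReal.ofReal_zero, lintegral_eq_zero_iff hf] at h0
    rw [h, ENNReal.ofReal_zero, zero_mul]
    symm
    refine lintegral_eq_zero_of_ae_eq_zero ?_
    filter_upwards [h0] with x hx
    simp only [Pi.zero_apply] at hx ⊢
    rw [hx, zero_mul]
  · have hb : Measurable fun x => ENNReal.ofReal (bayesFactor c β Z (t, y) x) :=
      ((measurable_bayesFactor c hZ).comp measurable_prodMk_left).ennreal_ofReal
    rw [← lintegral_const_mul _ (by exact hb.mul hφ)]
    refine lintegral_congr fun x => ?_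
    rw [← mul_assoc, ← ENNReal.ofReal_mul (c.mix_nonneg (responseLaw_nonneg β Z _) y),
      bayesFactor, if_neg h, NoiseChannel.ratio, mul_div_cancel₀ _ h]

include hZ in
-- At signals of marginal density zero the factor `1` leaves the belief unchanged; elsewhere Bayes'
-- rule with test function `1` shows the total mass to be one.
lemma isMarkovKernel_bayesUpdate : IsMarkovKernel (bayesUpdate c β Z) := by
  refine ⟨fun p => ⟨?_⟩⟩
  rw [bayesUpdate_apply c hZ, withDensity_apply _ MeasurableSet.univ, Measure.restrict_univ]
  by_cases h : c.mix (responseLaw β Z p.1) p.2 = 0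
  · simp [bayesFactor, h]
  · have h1 := mix_mul_lintegral_bayesFactor c (β := β) hZ p.1 p.2 (φ := 1) measurable_const
    simp only [Pi.one_apply, mul_one] at h1
    rw [lintegral_f_response c hZ] at h1
    have h2 : ENNReal.ofReal (c.mix (responseLaw β Z p.1) p.2) ≠ 0 := by
      simpa using lt_of_le_of_ne (c.mix_nonneg (responseLaw_nonneg β Z _) p.2) (Ne.symm h)
    exact (ENNReal.mul_eq_left h2 ENNReal.ofReal_ne_top).1 h1

instance [IsProbabilityMeasure τ] : IsProbabilityMeasure (signalLaw c τ β Z hZ) := by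
  unfold signalLaw; infer_instance

lemma lintegral_signalLaw [IsProbabilityMeasure τ] {φ : (T × E) × Y → ℝ≥0∞} (hφ : Measurable φ) :
    ∫⁻ p, φ p ∂(signalLaw c τ β Z hZ) =
      ∫⁻ t, ∫⁻ x, ∫⁻ y, ENNReal.ofReal (c.f (Z (t, x)) y) * φ ((t, x), y) ∂ν ∂(β t) ∂τ := by
  rw [signalLaw, Measure.lintegral_compProd hφ, Measure.lintegral_compProd
    (by exact hφ.lintegral_kernel_prod_right')]
  refine lintegral_congr fun t => lintegral_congr fun x => ?_
  rw [Kernel.comap_apply, c.kernel_apply, lintegral_withDensity_eq_lintegral_mul _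
    (c.measurable_f _).ennreal_ofReal (by exact hφ.comp measurable_prodMk_left)]
  rfl

/-- Bayes' rule. -/
lemma map_signalLaw_eq_compProd [IsProbabilityMeasure τ] [SigmaFinite ν] :
    (signalLaw c τ β Z hZ).map (fun p => ((p.1.1, p.2), p.1.2)) =
      (signalLaw c τ β Z hZ).map (fun p => (p.1.1, p.2)) ⊗ₘ bayesUpdate c β Z := by
  have := isMarkovKernel_bayesUpdate c (β := β) hZ
  refine Measure.ext_of_lintegral _ fun φ hφ => ?_
  have hG : Measurable fun q : T × Y => ∫⁻ x, φ (q, x) ∂(bayesUpdate c β Z q) :=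
    hφ.lintegral_kernel_prod_right'
  rw [lintegral_map hφ (by fun_prop), Measure.lintegral_compProd hφ, lintegral_map hG (by fun_prop),
    lintegral_signalLaw c hZ (φ := fun p => φ ((p.1.1, p.2), p.1.2)) (hφ.comp (by fun_prop)),
    lintegral_signalLaw c hZ
      (φ := fun p => ∫⁻ x, φ ((p.1.1, p.2), x) ∂(bayesUpdate c β Z (p.1.1, p.2)))
      (hG.comp (f := fun p : (T × E) × Y => (p.1.1, p.2)) (by fun_prop))]
  refine lintegral_congr fun t => ?_
  have hf : Measurable fun q : E × Y => ENNReal.ofReal (c.f (Z (t, q.1)) q.2) :=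
    (c.measurable_uncurry_f.comp (f := fun q : E × Y => (Z (t, q.1), q.2))
      ((hZ.comp (by fun_prop)).prodMk measurable_snd)).ennreal_ofReal
  have hA : AEMeasurable (Function.uncurry fun x y =>
      ENNReal.ofReal (c.f (Z (t, x)) y) * φ ((t, y), x)) ((β t).prod ν) :=
    (hf.mul (hφ.comp (f := fun q : E × Y => ((t, q.2), q.1)) (by fun_prop))).aemeasurable
  have hB : AEMeasurable (Function.uncurry fun x y =>
      ENNReal.ofReal (c.f (Z (t, x)) y) * ∫⁻ x', φ ((t, y), x') ∂(bayesUpdate c β Z (t, y)))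
      ((β t).prod ν) :=
    (hf.mul (hG.comp (f := fun q : E × Y => (t, q.2)) (by fun_prop))).aemeasurable
  -- By Tonelli the signal is integrated last; for fixed `t` and `y` the claim is then Bayes' rule
  -- for a test function.
  refine (lintegral_lintegral_swap hA).trans (Eq.trans ?_ (lintegral_lintegral_swap hB).symm)
  refine lintegral_congr fun y => ?_
  have hφy : Measurable fun x => φ ((t, y), x) := hφ.comp measurable_prodMk_left
  rw [lintegral_mul_const _ (by exact hf.comp measurable_prodMk_right), lintegral_f_response c hZ,
    bayesUpdate_apply c hZ, lintegral_withDensity_eq_lintegral_mul _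
      (by exact ((measurable_bayesFactor c hZ).comp measurable_prodMk_left).ennreal_ofReal) hφy,
    ← mix_mul_lintegral_bayesFactor c hZ t y hφy]
  rfl

lemma NoiseChannel.integral_kernel (z : Fin m) (φ : Y → ℝ) :
    ∫ y, φ y ∂(c.kernel z) = ∫ y, c.f z y * φ y ∂ν := by
  rw [c.kernel_apply, integral_withDensity_eq_integral_toReal_smul
    (c.measurable_f z).ennreal_ofReal (by simp)]
  simp [ENNReal.toReal_ofReal (c.nonneg z _)]

/-- Each response contributes at most `2 / log 2`, uniformly in `t`: the dominating function `(f +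
mix) / log 2` is an integrable sum of two probability densities. Finite entropy of the `f⁽ᶻ⁾` plays
no role here. -/
lemma integrable_infoDensity [IsProbabilityMeasure τ] :
    Integrable (infoDensity c β Z) (signalLaw c τ β Z hZ) := by
  refine ⟨(measurable_infoDensity c hZ).aestronglyMeasurable, ?_⟩
  have hi := (measurable_infoDensity c (β := β) hZ).enorm
  rw [HasFiniteIntegral, lintegral_signalLaw c hZ hi]
  have hl : 0 < Real.log 2 := Real.log_pos one_lt_two
  have key : ∀ t, ∫⁻ x, ∫⁻ y, ENNReal.ofReal (c.f (Z (t, x)) y) *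
      ‖infoDensity c β Z ((t, x), y)‖ₑ ∂ν ∂(β t) ≤
        ∑ z : Fin m, ENNReal.ofReal (2 / Real.log 2) := by
    intro t
    have hu := responseLaw_mem_stdSimplex (β := β) hZ t
    refine (lintegral_response hZ t fun z => ∫⁻ y, ENNReal.ofReal (c.f z y) *
      ‖Real.logb 2 (c.ratio (responseLaw β Z t) z y)‖ₑ ∂ν).trans_le
        (Finset.sum_le_sum fun z _ => ?_)
    rw [← lintegral_const_mul' _ _ ENNReal.ofReal_ne_top]
    calc _ ≤ ∫⁻ y, ENNReal.ofReal ((c.f z y + c.mix (responseLaw β Z t) y) / Real.log 2) ∂ν := by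
          refine lintegral_mono fun y => ?_
          rw [Real.enorm_eq_ofReal_abs, ← ENNReal.ofReal_mul (c.nonneg z y),
            ← ENNReal.ofReal_mul (hu.1 z)]
          refine ENNReal.ofReal_le_ofReal ((le_of_eq ?_).trans (c.abs_mul_logb_ratio_le hu z y))
          rw [abs_mul, abs_mul, abs_of_nonneg (hu.1 z), abs_of_nonneg (c.nonneg z y)]
      _ = ENNReal.ofReal (2 / Real.log 2) := by
          rw [← ofReal_integral_eq_lintegral_ofReal
            (f := fun y => (c.f z y + c.mix (responseLaw β Z t) y) / Real.log 2)
            (((c.integrable_f z).add (c.integrable_mix _)).div_const _)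
            (Filter.Eventually.of_forall fun y =>
              div_nonneg (add_nonneg (c.nonneg z y) (c.mix_nonneg hu.1 y)) hl.le),
            integral_div, integral_add (c.integrable_f z) (c.integrable_mix _), c.integral_f,
            c.integral_mix hu]
          norm_num
  refine (lintegral_mono key).trans_lt ?_
  simp [ENNReal.mul_lt_top_iff]

include hZ in
lemma integral_infoDensity_eq_phi
    (hc : ∀ z, Integrable (fun y => c.f z y * Real.logb 2 (c.f z y)) ν) (t : T) :
    ∫ x, ∫ y, infoDensity c β Z ((t, x), y) ∂(c.kernel (Z (t, x))) ∂(β t) =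
      c.phi (responseLaw β Z t) := by
  rw [c.phi_eq hc (responseLaw_mem_stdSimplex hZ t), ← integral_response hZ t fun z =>
    ∫ y, c.f z y * Real.logb 2 (c.ratio (responseLaw β Z t) z y) ∂ν]
  exact integral_congr_ae (Filter.Eventually.of_forall fun x => c.integral_kernel _ _)

include hZ in
lemma integrable_phi_responseLaw [IsProbabilityMeasure τ]
    (hc : ∀ z, Integrable (fun y => c.f z y * Real.logb 2 (c.f z y)) ν) :
    Integrable (fun t => c.phi (responseLaw β Z t)) τ := by
  have h := integrable_integral_of_compProd (integrable_integral_of_compProd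
    (integrable_infoDensity c (τ := τ) (β := β) hZ))
  simp only [Kernel.comap_apply] at h
  simpa only [integral_infoDensity_eq_phi c hZ hc] using h

/-- The mean information density is the mean mutual information of response and signal. -/
lemma integral_infoDensity [IsProbabilityMeasure τ]
    (hc : ∀ z, Integrable (fun y => c.f z y * Real.logb 2 (c.f z y)) ν) :
    ∫ p, infoDensity c β Z p ∂(signalLaw c τ β Z hZ) = ∫ t, c.phi (responseLaw β Z t) ∂τ := by
  have h : Integrable (infoDensity c β Z) ((τ ⊗ₘ β) ⊗ₘ c.kernel.comap Z hZ) :=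
    integrable_infoDensity c hZ
  rw [signalLaw, Measure.integral_compProd h,
    Measure.integral_compProd (integrable_integral_of_compProd h)]
  simp only [Kernel.comap_apply]
  simp only [integral_infoDensity_eq_phi c hZ hc]

end Bayes

/-! ### Entropies as integrals of a jointly measurable log-density. -/

section LogDensity

variable {d : ℕ} {T : Type*} [MeasurableSpace T]

lemma diffEntropy_eq_neg_integral {Θ : Set (Vec d)} (μ : Measure (Vec d)) [SigmaFinite μ]
    (hμ : μ ≪ volume) (hΘ : MeasurableSet Θ) (hμΘ : ∀ᵐ θ ∂μ, θ ∈ Θ) :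
    diffEntropy Θ μ = -∫ θ, Real.logb 2 (lebesgueDensity μ θ) ∂μ := by
  have h0 : μ.restrict Θ = μ := Measure.restrict_eq_self_of_ae_mem hμΘ
  have h1 := setIntegral_rnDeriv_smul (f := fun θ => Real.logb 2 (lebesgueDensity μ θ)) hμ hΘ
  rw [h0] at h1
  rw [← h1, ← integral_neg]
  rfl

/-- The conditional laws `β` of a classifier given `t` have, for `τ`-almost every `t`, a Lebesgue
density whose logarithm is `ℓ (t, ·)`, and `ℓ` is integrable. -/
structure HasLogDensity (τ : Measure T) (β : Kernel T (Vec d)) (ℓ : T × Vec d → ℝ) : Prop where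
  measurable : Measurable ℓ
  integrable : Integrable ℓ (τ ⊗ₘ β)
  ac : ∀ᵐ t ∂τ, β t ≪ volume
  eq : ∀ᵐ t ∂τ, ∀ᵐ θ ∂(β t), Real.logb 2 (lebesgueDensity (β t) θ) = ℓ (t, θ)

variable {τ : Measure T} {β : Kernel T (Vec d)} {ℓ : T × Vec d → ℝ}

lemma HasLogDensity.diffEntropy_eq [IsMarkovKernel β] (h : HasLogDensity τ β ℓ)
    {Θ : Set (Vec d)} (hΘ : MeasurableSet Θ) (hβ : ∀ᵐ t ∂τ, ∀ᵐ θ ∂(β t), θ ∈ Θ) :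
    ∀ᵐ t ∂τ, diffEntropy Θ (β t) = -∫ θ, ℓ (t, θ) ∂(β t) := by
  filter_upwards [h.ac, h.eq, hβ] with t h1 h2 h3
  rw [diffEntropy_eq_neg_integral _ h1 hΘ h3, integral_congr_ae h2]

/-- Almost every conditional law has an integrable log-density. -/
lemma HasLogDensity.ae_integrable [SFinite τ] [IsMarkovKernel β] (h : HasLogDensity τ β ℓ) :
    ∀ᵐ t ∂τ, Integrable (fun θ => ℓ (t, θ)) (β t) :=
  ((Measure.integrable_compProd_iff h.integrable.aestronglyMeasurable).1 h.integrable).1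

lemma HasLogDensity.integrable_diffEntropy [SFinite τ] [IsMarkovKernel β]
    (h : HasLogDensity τ β ℓ) {Θ : Set (Vec d)} (hΘ : MeasurableSet Θ)
    (hβ : ∀ᵐ t ∂τ, ∀ᵐ θ ∂(β t), θ ∈ Θ) : Integrable (fun t => diffEntropy Θ (β t)) τ :=
  (integrable_integral_of_compProd h.integrable).neg.congr
    ((h.diffEntropy_eq hΘ hβ).mono fun _ ht => ht.symm)

/-- Turns an expected entropy of conditional laws into one integral over the joint law, where a
change of variables applies. -/
lemma HasLogDensity.integral_diffEntropy [SFinite τ] [IsMarkovKernel β]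
    (h : HasLogDensity τ β ℓ) {Θ : Set (Vec d)} (hΘ : MeasurableSet Θ)
    (hβ : ∀ᵐ t ∂τ, ∀ᵐ θ ∂(β t), θ ∈ Θ) :
    ∫ t, diffEntropy Θ (β t) ∂τ = -∫ q, ℓ q ∂(τ ⊗ₘ β) := by
  rw [integral_congr_ae (h.diffEntropy_eq hΘ hβ), integral_neg,
    Measure.integral_compProd h.integrable]

end LogDensity

/-! ### The effect of one signal on the log-density; `e` encodes old data and signal as new data. -/

section Update

variable {d m : ℕ} {T T' Y : Type*} [MeasurableSpace T] [MeasurableSpace T'] [MeasurableSpace Y]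
  {ν : Measure Y} [SigmaFinite ν] (c : NoiseChannel m ν)
  {τ : Measure T} [IsProbabilityMeasure τ] {β : Kernel T (Vec d)} [IsMarkovKernel β]
  {Z : T × Vec d → Fin m} (hZ : Measurable Z) (e : T × Y ≃ᵐ T')
  {ρ : Measure (Vec d × T')} [IsFiniteMeasure ρ]
  (hρ : ρ = (signalLaw c τ β Z hZ).map fun p => (p.1.2, e (p.1.1, p.2)))

lemma measurePreserving_fst_signalLaw :
    MeasurePreserving Prod.fst (signalLaw c τ β Z hZ) (τ ⊗ₘ β) :=
  ⟨measurable_fst, Measure.fst_compProd _ _⟩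

include hρ

lemma map_snd_compProd_condDistrib : ρ.map Prod.snd ⊗ₘ condDistrib Prod.fst Prod.snd ρ =
    (signalLaw c τ β Z hZ).map fun p => (e (p.1.1, p.2), p.1.2) := by
  rw [compProd_map_condDistrib (by fun_prop), hρ, Measure.map_map (by fun_prop) (by fun_prop)]
  rfl

lemma map_snd_eq : ρ.map Prod.snd = (signalLaw c τ β Z hZ).map fun p => e (p.1.1, p.2) := by
  rw [hρ, Measure.map_map (by fun_prop) (by fun_prop)]
  rfl

/-- Conditional laws are almost surely unique, and the Bayes update disintegrates the joint law. -/
lemma condDistrib_ae_eq_bayesUpdate :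
    condDistrib Prod.fst Prod.snd ρ =ᵐ[ρ.map Prod.snd]
      (bayesUpdate c β Z).comap e.symm e.symm.measurable := by
  have := isMarkovKernel_bayesUpdate c (β := β) hZ
  refine condDistrib_ae_eq_of_measure_eq_compProd _ (by fun_prop) ?_
  rw [map_snd_eq c hZ e hρ, hρ, Measure.map_map (by fun_prop) (by fun_prop)]
  have h := map_signalLaw_eq_compProd c (τ := τ) (β := β) hZ
  refine Measure.ext_of_lintegral _ fun φ hφ => ?_
  have hφ' : Measurable fun q : (T × Y) × Vec d => φ (e q.1, q.2) := hφ.comp (by fun_prop)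
  rw [Measure.lintegral_compProd hφ, lintegral_map (f := fun s =>
    ∫⁻ θ, φ (s, θ) ∂((bayesUpdate c β Z).comap e.symm e.symm.measurable s))
    hφ.lintegral_kernel_prod_right' (by fun_prop), lintegral_map hφ (by fun_prop)]
  have h2 := congrArg (fun κ => ∫⁻ q, φ (e q.1, q.2) ∂κ) h
  simp only at h2
  rw [Measure.lintegral_compProd hφ', lintegral_map hφ' (by fun_prop),
    lintegral_map (f := fun s => ∫⁻ θ, φ (e s, θ) ∂(bayesUpdate c β Z s))
      hφ'.lintegral_kernel_prod_right' (by fun_prop)] at h2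
  simpa using h2

/-- Forgetting the signal recovers the law of the old data, so almost sure properties of the old
belief remain available after the update. -/
lemma measurePreserving_param : MeasurePreserving (fun s => (e.symm s).1) (ρ.map Prod.snd) τ := by
  refine ⟨by fun_prop, ?_⟩
  rw [map_snd_eq c hZ e hρ, Measure.map_map (by fun_prop) (by fun_prop)]
  have h : (fun s => (e.symm s).1) ∘ (fun p : (T × Vec d) × Y => e (p.1.1, p.2)) =
      Prod.fst ∘ Prod.fst := by ext p; simp
  rw [h, ← Measure.map_map measurable_fst measurable_fst,
    (measurePreserving_fst_signalLaw c hZ).map_eq]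
  exact Measure.fst_compProd _ _

/-- The log-density of the updated belief. -/
lemma HasLogDensity.update {ℓ : T × Vec d → ℝ} (h : HasLogDensity τ β ℓ) :
    HasLogDensity (ρ.map Prod.snd) (condDistrib Prod.fst Prod.snd ρ) fun q =>
      ℓ ((e.symm q.1).1, q.2) +
        infoDensity c β Z (((e.symm q.1).1, q.2), (e.symm q.1).2) := by
  have hm1 := h.measurable
  have hm2 := measurable_infoDensity c (β := β) hZ
  have hb := condDistrib_ae_eq_bayesUpdate c hZ e hρ
  have hq := (measurePreserving_param c hZ e hρ).quasiMeasurePreserving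
  refine ⟨by fun_prop, ?_, ?_, ?_⟩
  · rw [map_snd_compProd_condDistrib c hZ e hρ, integrable_map_measure
      (Measurable.aestronglyMeasurable (by fun_prop)) (by fun_prop)]
    simp only [Function.comp_def, MeasurableEquiv.symm_apply_apply]
    exact ((measurePreserving_fst_signalLaw c hZ).integrable_comp_of_integrable h.integrable).add
        (integrable_infoDensity c hZ)
  · filter_upwards [hb, hq.ae h.ac] with s h1 h2
    rw [h1, Kernel.comap_apply, bayesUpdate_apply c hZ]
    exact (withDensity_absolutelyContinuous _ _).trans h2
  · filter_upwards [hb, hq.ae h.ac, hq.ae h.eq] with s h1 h2 h3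
    rw [h1, Kernel.comap_apply, bayesUpdate_apply c hZ]
    have hr : Measurable fun θ => ENNReal.ofReal (bayesFactor c β Z (e.symm s) θ) :=
      ((measurable_bayesFactor c hZ).comp measurable_prodMk_left).ennreal_ofReal
    have h4 := h2.ae_le (Measure.rnDeriv_withDensity_left_of_absolutelyContinuous h2 hr.aemeasurable)
    -- The updated belief only sees points where the Bayes factor is nonzero, and the old density is
    -- positive and finite almost everywhere under the old belief; so the logarithm of the product
    -- splits.
    rw [ae_withDensity_iff hr]
    filter_upwards [h3, h4, Measure.rnDeriv_pos h2,
      h2.ae_le (Measure.rnDeriv_ne_top (β (e.symm s).1) volume)] with θ h5 h6 h7 h8 h9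
    rw [← h5, ← logb_bayesFactor, lebesgueDensity, lebesgueDensity, h6, ENNReal.toReal_mul,
      ENNReal.toReal_ofReal (bayesFactor_nonneg c _ _), Real.logb_mul, add_comm]
    · intro h0; simp [h0] at h9
    · exact (ENNReal.toReal_pos h7.ne' h8).ne'

/-- Pulled back to the joint law of data, classifier and signal, the old log-density keeps its
integral and the added term has the mean of `φ`. This is the one-epoch entropy balance. -/
lemma HasLogDensity.integral_update {ℓ : T × Vec d → ℝ} (h : HasLogDensity τ β ℓ)
    (hc : ∀ z, Integrable (fun y => c.f z y * Real.logb 2 (c.f z y)) ν) :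
    ∫ q, (ℓ ((e.symm q.1).1, q.2) +
        infoDensity c β Z (((e.symm q.1).1, q.2), (e.symm q.1).2))
        ∂(ρ.map Prod.snd ⊗ₘ condDistrib Prod.fst Prod.snd ρ) =
      ∫ q, ℓ q ∂(τ ⊗ₘ β) + ∫ t, c.phi (responseLaw β Z t) ∂τ := by
  have hm1 := h.measurable
  have hm2 := measurable_infoDensity c (β := β) hZ
  have hp := measurePreserving_fst_signalLaw c (τ := τ) (β := β) hZ
  have hi : Integrable (fun p : (T × Vec d) × Y => ℓ p.1) (signalLaw c τ β Z hZ) :=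
    hp.integrable_comp_of_integrable h.integrable
  rw [map_snd_compProd_condDistrib c hZ e hρ, integral_map (by fun_prop)
    (Measurable.aestronglyMeasurable (by fun_prop)), ← integral_infoDensity c hZ hc,
    ← hp.map_eq, integral_map (by fun_prop) (by fun_prop),
    ← integral_add hi (integrable_infoDensity c hZ)]
  simp

end Update

lemma integrable_logb_lebesgueDensity {d : ℕ} {Θ : Set (Vec d)} {μ : Measure (Vec d)}
    [SigmaFinite μ] (hμ : μ ≪ volume) (hΘ : MeasurableSet Θ) (hμΘ : ∀ᵐ θ ∂μ, θ ∈ Θ)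
    (hent : Integrable (fun θ => lebesgueDensity μ θ * Real.logb 2 (lebesgueDensity μ θ))
      (volume.restrict Θ)) :
    Integrable (fun θ => Real.logb 2 (lebesgueDensity μ θ)) μ := by
  have h0 : μ = (volume.restrict Θ).withDensity (μ.rnDeriv volume) := by
    rw [← restrict_withDensity hΘ, Measure.withDensity_rnDeriv_eq _ _ hμ,
      Measure.restrict_eq_self_of_ae_mem hμΘ]
  suffices h : Integrable (fun θ => Real.logb 2 (lebesgueDensity μ θ))
      ((volume.restrict Θ).withDensity (μ.rnDeriv volume)) by rwa [← h0] at h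
  rw [integrable_withDensity_iff_integrable_smul' (Measure.measurable_rnDeriv _ _)
    (ae_restrict_of_ae (Measure.rnDeriv_lt_top μ volume))]
  exact hent

lemma ae_ae_condDistrib_mem {d : ℕ} {T : Type*} [MeasurableSpace T] {ρ : Measure (Vec d × T)}
    [IsFiniteMeasure ρ] {Θ : Set (Vec d)} (hΘ : MeasurableSet Θ) (hρ : ∀ᵐ q ∂ρ, q.1 ∈ Θ) :
    ∀ᵐ t ∂(ρ.map Prod.snd), ∀ᵐ θ ∂(condDistrib Prod.fst Prod.snd ρ t), θ ∈ Θ := by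
  refine Measure.ae_ae_of_ae_compProd (p := fun q => q.2 ∈ Θ) ?_
  rw [compProd_map_condDistrib (by fun_prop),
    ae_map_iff (by fun_prop) (measurable_snd hΘ)]
  exact hρ

/-! ### The information gain of a fixed question. -/

section Predictive

variable {d m : ℕ} {S : Set (Vec d)} [NeZero m]

lemma predictive_eq {Θ : Set (Vec d)} {μ : Measure (Vec d)} (hμΘ : ∀ᵐ θ ∂μ, θ ∈ Θ)
    (X : Question S m) : predictive Θ μ X = fun z => μ.real {θ | trueResponse X θ = z} := by
  funext z
  refine measureReal_congr ?_
  filter_upwards [hμΘ] with θ hθ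
  refine propext ?_
  change θ ∈ consistentSet Θ X z ↔ trueResponse X θ = z
  rw [trueResponse_eq_iff]
  exact and_iff_right hθ

lemma measurable_trueResponse_left (X : Question S m) :
    Measurable fun θ : Vec d => trueResponse X θ :=
  (measurable_trueResponse (d := d) (m := m) (S := S)).comp
    (f := fun θ => (θ, X)) (measurable_id.prodMk measurable_const)

variable {Y : Type*} [MeasurableSpace Y] {ν : Measure Y} [SigmaFinite ν] (c : NoiseChannel m ν)

/-- The information gain of a question is `φ` of its predictive distribution. -/
theorem mutualInfo_eq_phi (hc : ∀ z, Integrable (fun y => c.f z y * Real.logb 2 (c.f z y)) ν)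
    {Θ : Set (Vec d)} (hΘ : MeasurableSet Θ) {μ : Measure (Vec d)} [IsProbabilityMeasure μ]
    (hμ : μ ≪ volume) (hμΘ : ∀ᵐ θ ∂μ, θ ∈ Θ)
    (hent : Integrable (fun θ => Real.logb 2 (lebesgueDensity μ θ)) μ) (X : Question S m) :
    mutualInfo c Θ μ X = c.phi (predictive Θ μ X) := by
  -- The general update is applied with a one-point parameter space, so that the new data are the
  -- signal alone.
  let β : Kernel Unit (Vec d) := Kernel.const Unit μ
  let Z : Unit × Vec d → Fin m := fun q => trueResponse X q.2
  have hZ : Measurable Z := (measurable_trueResponse_left X).comp measurable_snd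
  have hmeas : Measurable (lebesgueDensity μ) := (Measure.measurable_rnDeriv _ _).ennreal_toReal
  have hℓ : HasLogDensity (Measure.dirac ()) β
      (fun q => Real.logb 2 (lebesgueDensity μ q.2)) := by
    have hm : Measurable fun q : Unit × Vec d => Real.logb 2 (lebesgueDensity μ q.2) := by
      unfold Real.logb; fun_prop
    refine ⟨hm, ?_, by simpa [β] using hμ, by simp [β]⟩
    rw [Measure.integrable_compProd_iff hm.aestronglyMeasurable]
    simpa [β] using hent
  let e : Unit × Y ≃ᵐ Y := MeasurableEquiv.punitProd
  have hρ : oneStepLaw c μ X =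
      (signalLaw c (Measure.dirac ()) β Z hZ).map fun p => (p.1.2, e (p.1.1, p.2)) := by
    refine Measure.ext_of_lintegral _ fun φ hφ => ?_
    have h1 : Measurable fun p : (Unit × Vec d) × Y => φ (p.1.2, p.2) := by fun_prop
    rw [lintegral_map hφ (by fun_prop), oneStepLaw, Measure.lintegral_compProd hφ, signalLaw]
    refine Eq.trans ?_ (Measure.lintegral_compProd h1).symm
    rw [Measure.lintegral_compProd (by exact h1.lintegral_kernel_prod_right')]
    simp [β, Z, NoiseChannel.signal, Kernel.comap_apply]
  have hΘ1 : ∀ᵐ t ∂(oneStepLaw c μ X).map Prod.snd,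
      ∀ᵐ θ ∂(condDistrib Prod.fst Prod.snd (oneStepLaw c μ X) t), θ ∈ Θ := by
    refine ae_ae_condDistrib_mem hΘ ?_
    have hfst : MeasurePreserving Prod.fst (oneStepLaw c μ X) μ :=
      ⟨measurable_fst, Measure.fst_compProd _ _⟩
    exact hfst.quasiMeasurePreserving.ae hμΘ
  have h1 := (hℓ.update c hZ e hρ).integral_diffEntropy hΘ hΘ1
  rw [hℓ.integral_update c hZ e hρ hc, Measure.integral_compProd hℓ.integrable] at h1
  rw [mutualInfo, condEntropy]
  simp only [posteriorEntropy]
  rw [h1, diffEntropy_eq_neg_integral μ hμ hΘ hμΘ, predictive_eq hμΘ]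
  simp only [integral_dirac]
  simp [β, Z]
  rfl

end Predictive

/-! ### The dynamics: beliefs and expected entropy from one epoch to the next. -/

section Epochs

variable {d m : ℕ} {S : Set (Vec d)} {Y : Type*} [MeasurableSpace Y] {ν : Measure Y}

/-- Appending a question and a signal to a history, as an equivalence. -/
def historySnoc (S : Set (Vec d)) (m : ℕ) (Y : Type*) [MeasurableSpace Y] (k : ℕ) :
    (History S m Y k × Question S m) × Y ≃ᵐ History S m Y (k + 1) where
  toFun p := Fin.snoc p.1.1 (p.1.2, p.2)
  invFun h := ((Fin.init h, (h (Fin.last k)).1), (h (Fin.last k)).2)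
  left_inv p := by simp
  right_inv h := by simp
  measurable_toFun := by
    refine measurable_pi_lambda _ fun i => ?_
    refine Fin.lastCases ?_ (fun j => ?_) i
    · simp only [Equiv.coe_fn_mk, Fin.snoc_last]; fun_prop
    · simp only [Equiv.coe_fn_mk, Fin.snoc_castSucc]; fun_prop
  measurable_invFun := by
    have : Measurable fun h : History S m Y (k + 1) => (Fin.init h : History S m Y k) :=
      measurable_pi_lambda _ fun i => measurable_pi_apply (Fin.castSucc i)
    simp only [Equiv.coe_fn_symm_mk]
    fun_prop

variable [NeZero m] (c : NoiseChannel m ν) (μ : Measure (Vec d)) [IsProbabilityMeasure μ]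
  (π : Policy S m Y)

/-- The law of the first `k` questions and signals. -/
def historyLaw (k : ℕ) : Measure (History S m Y k) := (law c μ π k).map Prod.snd

instance (k : ℕ) : IsProbabilityMeasure (historyLaw c μ π k) :=
  Measure.isProbabilityMeasure_map measurable_snd.aemeasurable

/-- The law of the history before epoch `k` and of the question posed at epoch `k`. -/
def questionLaw (k : ℕ) : Measure (History S m Y k × Question S m) :=
  historyLaw c μ π k ⊗ₘ π.ask k

instance (k : ℕ) : IsProbabilityMeasure (questionLaw c μ π k) := by
  unfold questionLaw; infer_instance

/-- The belief before epoch `k`, which does not depend on the question posed at epoch `k`. -/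
def questionBelief (k : ℕ) : Kernel (History S m Y k × Question S m) (Vec d) :=
  (belief c μ π k).prodMkRight (Question S m)

instance (k : ℕ) : IsMarkovKernel (questionBelief c μ π k) := by
  unfold questionBelief; infer_instance

lemma measurable_response (k : ℕ) :
    Measurable fun q : (History S m Y k × Question S m) × Vec d => trueResponse q.1.2 q.2 :=
  (measurable_trueResponse (d := d) (m := m) (S := S)).comp
    (f := fun q : (History S m Y k × Question S m) × Vec d => (q.2, q.1.2)) (by fun_prop)

lemma historyLaw_compProd_belief (k : ℕ) : historyLaw c μ π k ⊗ₘ belief c μ π k =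
    (law c μ π k).map Prod.swap :=
  compProd_map_condDistrib measurable_fst.aemeasurable

/-- Puts an epoch into the form of the general update, with history and question as parameter. It
holds because the policy sees the history only: given the history, question and classifier are
independent, so the question leaves the belief unchanged. -/
lemma law_succ_eq (k : ℕ) : law c μ π (k + 1) =
    (signalLaw c (questionLaw c μ π k) (questionBelief c μ π k)
      (fun q => trueResponse q.1.2 q.2) (measurable_response k)).map
        fun p => (p.1.2, historySnoc S m Y k (p.1.1, p.2)) := by
  refine Measure.ext_of_lintegral _ fun φ hφ => ?_
  have hext := measurable_extend (d := d) (m := m) (S := S) (Y := Y) k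
  let F : (Vec d × History S m Y k) × Question S m → ENNReal := fun q =>
    ∫⁻ y, φ (q.1.1, historySnoc S m Y k ((q.1.2, q.2), y)) ∂(c.kernel (trueResponse q.2 q.1.1))
  have hF : Measurable F := by
    have hr : Measurable fun q : (Vec d × History S m Y k) × Question S m =>
        trueResponse q.2 q.1.1 :=
      (measurable_trueResponse (d := d) (m := m) (S := S)).comp
        (f := fun q : (Vec d × History S m Y k) × Question S m => (q.1.1, q.2)) (by fun_prop)
    have hφ' : Measurable fun p : ((Vec d × History S m Y k) × Question S m) × Y =>
        φ (p.1.1.1, historySnoc S m Y k ((p.1.1.2, p.1.2), p.2)) := by fun_prop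
    exact hφ'.lintegral_kernel_prod_right' (κ := c.kernel.comap _ hr)
  have hF2 : Measurable fun q : Vec d × History S m Y k => ∫⁻ x, F (q, x) ∂(π.ask k q.2) :=
    hF.lintegral_kernel_prod_right' (κ := (π.ask k).comap Prod.snd measurable_snd)
  have hL : ∫⁻ ω, φ ω ∂(law c μ π (k + 1)) =
      ∫⁻ h, ∫⁻ θ, ∫⁻ x, F ((θ, h), x) ∂(π.ask k h) ∂(belief c μ π k h) ∂(historyLaw c μ π k) := by
    have h1 : ∫⁻ q, ∫⁻ x, F (q, x) ∂(π.ask k q.2) ∂(law c μ π k) =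
        ∫⁻ r, ∫⁻ x, F (r.swap, x) ∂(π.ask k r.1) ∂(historyLaw c μ π k ⊗ₘ belief c μ π k) := by
      rw [historyLaw_compProd_belief, lintegral_map (by exact hF2.comp measurable_swap)
        measurable_swap]
      rfl
    rw [Measure.lintegral_compProd (by exact hF2.comp measurable_swap)] at h1
    refine Eq.trans ?_ h1
    rw [law, lintegral_map hφ hext, Measure.lintegral_compProd (by exact hφ.comp hext)]
    refine lintegral_congr fun q => ?_
    rw [epoch, Kernel.lintegral_compProd _ _ _ (by exact (hφ.comp hext).comp measurable_prodMk_left)]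
    rfl
  have hφ' : Measurable fun p : ((History S m Y k × Question S m) × Vec d) × Y =>
      φ (p.1.2, historySnoc S m Y k (p.1.1, p.2)) := by fun_prop
  have hFβ : Measurable fun q : (History S m Y k × Question S m) × Vec d =>
      F ((q.2, q.1.1), q.1.2) := by fun_prop
  rw [hL, lintegral_map hφ (by fun_prop), signalLaw]
  refine Eq.trans ?_ (Measure.lintegral_compProd hφ').symm
  refine Eq.trans ?_ (Measure.lintegral_compProd hFβ).symm
  refine Eq.trans (lintegral_congr fun h => ?_) (Measure.lintegral_compProd
    (hFβ.lintegral_kernel_prod_right' (κ := questionBelief c μ π k))).symm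
  -- The conditional independence of classifier and question enters as an exchange of their
  -- integrals for a fixed history.
  exact lintegral_lintegral_swap (Measurable.aemeasurable (by
    exact hF.comp (f := fun p : Vec d × Question S m => ((p.1, h), p.2)) (by fun_prop)))

lemma measurePreserving_init (k : ℕ) :
    MeasurePreserving (fun ω : Vec d × History S m Y (k + 1) =>
      ((ω.1, Fin.init ω.2) : Vec d × History S m Y k)) (law c μ π (k + 1)) (law c μ π k) := by
  have hinit : Measurable fun h : History S m Y (k + 1) => (Fin.init h : History S m Y k) :=
    measurable_pi_lambda _ fun i => measurable_pi_apply (Fin.castSucc i)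
  refine ⟨by fun_prop, ?_⟩
  rw [law, Measure.map_map (by fun_prop) (measurable_extend k)]
  have h : (fun ω : Vec d × History S m Y (k + 1) =>
      ((ω.1, Fin.init ω.2) : Vec d × History S m Y k)) ∘ extend k = Prod.fst := by
    funext p; simp [extend]
  rw [h]
  exact Measure.fst_compProd _ _

lemma measurePreserving_fst_law (k : ℕ) : MeasurePreserving Prod.fst (law c μ π k) μ := by
  induction k with
  | zero =>
    refine ⟨measurable_fst, ?_⟩
    rw [law, Measure.map_map measurable_fst measurable_prodMk_right]
    exact Measure.map_id
  | succ k ih => exact ih.comp (measurePreserving_init c μ π k)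

lemma measurePreserving_snd_law (k : ℕ) :
    MeasurePreserving Prod.snd (law c μ π k) (historyLaw c μ π k) := ⟨measurable_snd, rfl⟩

lemma measurePreserving_fst_questionLaw (k : ℕ) :
    MeasurePreserving Prod.fst (questionLaw c μ π k) (historyLaw c μ π k) :=
  ⟨measurable_fst, Measure.fst_compProd _ _⟩

/-- The past and the question of epoch `k`, read off a longer history. -/
lemma measurePreserving_past [SigmaFinite ν] {K : ℕ} (k : Fin K) :
    MeasurePreserving (fun ω : Vec d × History S m Y K => (past ω.2 k, (ω.2 k).1))
      (law c μ π K) (questionLaw c μ π k) := by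
  induction K with
  | zero => exact k.elim0
  | succ K ih =>
    -- For the last epoch the pair is the parameter of the update; for an earlier one the last entry
    -- is dropped first.
    refine Fin.lastCases ?_ (fun j => ?_) k
    · exact (measurePreserving_param c (measurable_response K) (historySnoc S m Y K)
        (law_succ_eq c μ π K)).comp (measurePreserving_snd_law c μ π (K + 1))
    · exact (ih j).comp (measurePreserving_init c μ π K)

lemma ae_ae_belief_mem {Θ : Set (Vec d)} (hΘ : MeasurableSet Θ) (hμΘ : ∀ᵐ θ ∂μ, θ ∈ Θ) (k : ℕ) :
    ∀ᵐ h ∂(historyLaw c μ π k), ∀ᵐ θ ∂(belief c μ π k h), θ ∈ Θ :=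
  ae_ae_condDistrib_mem hΘ ((measurePreserving_fst_law c μ π k).quasiMeasurePreserving.ae hμΘ)

lemma belief_zero_ae_eq :
    ∀ᵐ h ∂(historyLaw c μ π 0), belief c μ π 0 h = μ := by
  refine condDistrib_ae_eq_of_measure_eq_compProd (κ := Kernel.const _ μ) _
    measurable_fst.aemeasurable ?_
  rw [Measure.compProd_const, law, Measure.map_map (by fun_prop) (by fun_prop),
    Measure.map_map (by fun_prop) (by fun_prop)]
  have h : Prod.snd ∘ (fun θ : Vec d => ((θ, Fin.elim0) : Vec d × History S m Y 0)) =
    fun _ => Fin.elim0 := rfl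
  rw [h, Measure.map_const, measure_univ, one_smul, Measure.dirac_prod]
  rfl

lemma hasLogDensity_zero (hμ : μ ≪ volume)
    (hent : Integrable (fun θ => Real.logb 2 (lebesgueDensity μ θ)) μ) :
    HasLogDensity (historyLaw c μ π 0) (belief c μ π 0)
      (fun q => Real.logb 2 (lebesgueDensity μ q.2)) := by
  have hmeas : Measurable (lebesgueDensity μ) := (Measure.measurable_rnDeriv _ _).ennreal_toReal
  have hb := belief_zero_ae_eq c μ π
  refine ⟨by unfold Real.logb; fun_prop, ?_, ?_, ?_⟩
  · rw [historyLaw_compProd_belief]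
    have h : MeasurePreserving Prod.snd ((law c μ π 0).map Prod.swap) μ := by
      refine ⟨measurable_snd, ?_⟩
      rw [Measure.map_map measurable_snd measurable_swap]
      exact (measurePreserving_fst_law c μ π 0).map_eq
    exact h.integrable_comp_of_integrable hent
  · filter_upwards [hb] with h hh
    rwa [hh]
  · filter_upwards [hb] with h hh
    rw [hh]
    exact Filter.Eventually.of_forall fun _ => rfl

lemma measurePreserving_questionBelief (k : ℕ) :
    MeasurePreserving (fun q : (History S m Y k × Question S m) × Vec d => (q.1.1, q.2))
      (questionLaw c μ π k ⊗ₘ questionBelief c μ π k) (historyLaw c μ π k ⊗ₘ belief c μ π k) := by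
  refine ⟨by fun_prop, Measure.ext_of_lintegral _ fun φ hφ => ?_⟩
  have h1 : Measurable fun h => ∫⁻ θ, φ (h, θ) ∂(belief c μ π k h) :=
    hφ.lintegral_kernel_prod_right'
  rw [lintegral_map hφ (by fun_prop), Measure.lintegral_compProd (by fun_prop),
    Measure.lintegral_compProd hφ,
    ← (measurePreserving_fst_questionLaw c μ π k).lintegral_comp h1]
  rfl

lemma HasLogDensity.question {k : ℕ} {ℓ : History S m Y k × Vec d → ℝ}
    (h : HasLogDensity (historyLaw c μ π k) (belief c μ π k) ℓ) :
    HasLogDensity (questionLaw c μ π k) (questionBelief c μ π k) fun q => ℓ (q.1.1, q.2) := by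
  have hm := h.measurable
  have hq := (measurePreserving_fst_questionLaw c μ π k).quasiMeasurePreserving
  exact ⟨by fun_prop,
    (measurePreserving_questionBelief c μ π k).integrable_comp_of_integrable h.integrable,
    hq.ae h.ac, hq.ae h.eq⟩

lemma HasLogDensity.succ [SigmaFinite ν] {k : ℕ} {ℓ : History S m Y k × Vec d → ℝ}
    (h : HasLogDensity (historyLaw c μ π k) (belief c μ π k) ℓ) :
    ∃ ℓ', HasLogDensity (historyLaw c μ π (k + 1)) (belief c μ π (k + 1)) ℓ' :=
  ⟨_, (h.question c μ π).update c (measurable_response k) (historySnoc S m Y k)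
    (law_succ_eq c μ π k)⟩

/-- Existence suffices: the entropies do not depend on the choice of log-density, so no formula
accumulated over epochs is needed. -/
lemma exists_hasLogDensity [SigmaFinite ν] (hμ : μ ≪ volume)
    (hent : Integrable (fun θ => Real.logb 2 (lebesgueDensity μ θ)) μ) (k : ℕ) :
    ∃ ℓ, HasLogDensity (historyLaw c μ π k) (belief c μ π k) ℓ := by
  induction k with
  | zero => exact ⟨_, hasLogDensity_zero c μ π hμ hent⟩
  | succ k ih =>
    obtain ⟨ℓ, h⟩ := ih
    exact h.succ c μ π

/-- The gain of information at epoch `k`, as a function of its past and of its question. -/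
def epochGain (Θ : Set (Vec d)) (k : ℕ) (q : History S m Y k × Question S m) : ℝ :=
  c.phi (predictive Θ (belief c μ π k q.1) q.2)

lemma ae_predictive_eq_responseLaw {Θ : Set (Vec d)} (hΘ : MeasurableSet Θ)
    (hμΘ : ∀ᵐ θ ∂μ, θ ∈ Θ) (k : ℕ) :
    ∀ᵐ q ∂(questionLaw c μ π k), predictive Θ (belief c μ π k q.1) q.2 =
      responseLaw (questionBelief c μ π k) (fun q => trueResponse q.1.2 q.2) q := by
  filter_upwards [(measurePreserving_fst_questionLaw c μ π k).quasiMeasurePreserving.ae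
    (ae_ae_belief_mem c μ π hΘ hμΘ k)] with q hq
  exact predictive_eq hq q.2

variable (hc : ∀ z, Integrable (fun y => c.f z y * Real.logb 2 (c.f z y)) ν)
  {Θ : Set (Vec d)} (hΘ : MeasurableSet Θ) (hμ : μ ≪ volume) (hμΘ : ∀ᵐ θ ∂μ, θ ∈ Θ)
  (hent : Integrable (fun θ => Real.logb 2 (lebesgueDensity μ θ)) μ)

include hΘ hμΘ in
lemma ae_predictive_mem_stdSimplex (k : ℕ) : ∀ᵐ q ∂(questionLaw c μ π k),
    predictive Θ (belief c μ π k q.1) q.2 ∈ stdSimplex ℝ (Fin m) := by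
  filter_upwards [ae_predictive_eq_responseLaw c μ π hΘ hμΘ k] with q hq
  rw [hq]
  exact responseLaw_mem_stdSimplex (measurable_response k) q

include hc hΘ hμΘ in
lemma integrable_epochGain (k : ℕ) : Integrable (epochGain c μ π Θ k) (questionLaw c μ π k) := by
  refine (integrable_phi_responseLaw c (τ := questionLaw c μ π k)
    (β := questionBelief c μ π k) (measurable_response k) hc).congr ?_
  filter_upwards [ae_predictive_eq_responseLaw c μ π hΘ hμΘ k] with q hq
  rw [epochGain, hq]

include hΘ hμ hμΘ hent in
lemma integrable_posteriorEntropy [SigmaFinite ν] (k : ℕ) :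
    Integrable (posteriorEntropy Θ (law c μ π k)) ((law c μ π k).map Prod.snd) := by
  obtain ⟨ℓ, h⟩ := exists_hasLogDensity c μ π hμ hent k
  exact h.integrable_diffEntropy hΘ (ae_ae_belief_mem c μ π hΘ hμΘ k)

lemma condEntropy_eq_neg_integral {k : ℕ} {ℓ : History S m Y k × Vec d → ℝ}
    (h : HasLogDensity (historyLaw c μ π k) (belief c μ π k) ℓ) (hΘ : MeasurableSet Θ)
    (hμΘ : ∀ᵐ θ ∂μ, θ ∈ Θ) : condEntropy Θ (law c μ π k) =
      -∫ q, ℓ q ∂(historyLaw c μ π k ⊗ₘ belief c μ π k) :=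
  h.integral_diffEntropy hΘ (ae_ae_belief_mem c μ π hΘ hμΘ k)

include hΘ hμ hμΘ hent in
lemma condEntropy_zero : condEntropy Θ (law c μ π 0) = diffEntropy Θ μ := by
  have hmeas : Measurable (lebesgueDensity μ) := (Measure.measurable_rnDeriv _ _).ennreal_toReal
  rw [condEntropy_eq_neg_integral c μ π (hasLogDensity_zero c μ π hμ hent) hΘ hμΘ,
    historyLaw_compProd_belief, diffEntropy_eq_neg_integral μ hμ hΘ hμΘ,
    integral_map (by fun_prop) (Measurable.aestronglyMeasurable (by unfold Real.logb; fun_prop))]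
  have h := integral_map (μ := law c μ π 0) measurable_fst.aemeasurable
    (f := fun θ => Real.logb 2 (lebesgueDensity μ θ))
    (Measurable.aestronglyMeasurable (by unfold Real.logb; fun_prop))
  rw [(measurePreserving_fst_law c μ π 0).map_eq] at h
  rw [h]
  rfl

include hc hΘ hμ hμΘ hent in
/-- The expected entropy loss in one epoch. -/
lemma condEntropy_succ [SigmaFinite ν] (k : ℕ) : condEntropy Θ (law c μ π (k + 1)) =
    condEntropy Θ (law c μ π k) - ∫ q, epochGain c μ π Θ k q ∂(questionLaw c μ π k) := by
  obtain ⟨ℓ, h⟩ := exists_hasLogDensity c μ π hμ hent k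
  have hQ := h.question c μ π
  have hp := measurePreserving_questionBelief c μ π k
  have hu := hQ.update c (measurable_response k) (historySnoc S m Y k) (law_succ_eq c μ π k)
  have hi := hQ.integral_update c (measurable_response k) (historySnoc S m Y k)
    (law_succ_eq c μ π k) hc
  have hg : ∫ q, epochGain c μ π Θ k q ∂(questionLaw c μ π k) =
      ∫ q, c.phi (responseLaw (questionBelief c μ π k) (fun q => trueResponse q.1.2 q.2) q)
        ∂(questionLaw c μ π k) := by
    refine integral_congr_ae ?_
    filter_upwards [ae_predictive_eq_responseLaw c μ π hΘ hμΘ k] with q hq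
    rw [epochGain, hq]
  -- The entropy before the epoch is rewritten on the space with the question adjoined, where it
  -- meets the first term of the update formula.
  rw [condEntropy_eq_neg_integral c μ π h hΘ hμΘ, hg, ← hp.map_eq,
    integral_map (by fun_prop) h.measurable.aestronglyMeasurable]
  rw [condEntropy_eq_neg_integral c μ π hu hΘ hμΘ]
  refine (congrArg Neg.neg hi).trans ?_
  ring

include hc hΘ hμ hμΘ hent in
lemma condEntropy_eq_sub_sum [SigmaFinite ν] (K : ℕ) : condEntropy Θ (law c μ π K) =
    diffEntropy Θ μ -
      ∑ k : Fin K, ∫ q, epochGain c μ π Θ k q ∂(questionLaw c μ π k) := by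
  induction K with
  | zero => simp [condEntropy_zero c μ π hΘ hμ hμΘ hent]
  | succ K ih =>
    rw [condEntropy_succ c μ π hc hΘ hμ hμΘ hent, ih, Fin.sum_univ_castSucc]
    simp only [Fin.val_castSucc, Fin.val_last]
    ring


end Epochs

/-! ### The lower bound, its equality case, and entropy pursuit. -/

section Optimality

variable {d m : ℕ} [NeZero m] {S : Set (Vec d)} {Y : Type*} [MeasurableSpace Y] {ν : Measure Y}
  [SigmaFinite ν] (c : NoiseChannel m ν) (μ : Measure (Vec d)) [IsProbabilityMeasure μ]
  (π : Policy S m Y)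
  (hc : ∀ z, Integrable (fun y => c.f z y * Real.logb 2 (c.f z y)) ν)
  {Θ : Set (Vec d)} (hΘ : MeasurableSet Θ) (hμ : μ ≪ volume) (hμΘ : ∀ᵐ θ ∂μ, θ ∈ Θ)
  (hent : Integrable (fun θ => Real.logb 2 (lebesgueDensity μ θ)) μ) {K : ℕ}

lemma nonempty_policy (hS : S.Nonempty) : Nonempty (Policy S m Y) :=
  ⟨⟨fun _ => Kernel.const _ (Measure.dirac fun _ => ⟨hS.some, hS.some_mem⟩),
    fun _ => inferInstance⟩⟩

include hc in
lemma NoiseChannel.phi_le_capacity {u : Fin m → ℝ} (hu : u ∈ stdSimplex ℝ (Fin m)) :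
    c.phi u ≤ c.capacity :=
  (c.isGreatest_capacity hc).2 (mem_image_of_mem _ hu)

include hΘ hμΘ in
lemma ae_askedPredictive_mem_stdSimplex : ∀ᵐ ω ∂(law c μ π K), ∀ k : Fin K,
    askedPredictive c Θ μ π ω.2 k ∈ stdSimplex ℝ (Fin m) :=
  ae_all_iff.2 fun k => (measurePreserving_past c μ π k).quasiMeasurePreserving.ae
    (ae_predictive_mem_stdSimplex c μ π hΘ hμΘ k)

include hc hΘ hμΘ in
lemma integrable_phi_askedPredictive (k : Fin K) :
    Integrable (fun ω => c.phi (askedPredictive c Θ μ π ω.2 k)) (law c μ π K) :=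
  (measurePreserving_past c μ π k).integrable_comp_of_integrable
    (integrable_epochGain c μ π hc hΘ hμΘ k)

include hc hΘ hμ hμΘ hent in
/-- The expected entropy reduction under a policy. -/
lemma diffEntropy_sub_condEntropy : diffEntropy Θ μ - condEntropy Θ (law c μ π K) =
    ∫ ω, ∑ k : Fin K, c.phi (askedPredictive c Θ μ π ω.2 k) ∂(law c μ π K) := by
  rw [condEntropy_eq_sub_sum c μ π hc hΘ hμ hμΘ hent,
    integral_finsetSum _ fun k _ => integrable_phi_askedPredictive c μ π hc hΘ hμΘ k,
    sub_sub_cancel]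
  refine Finset.sum_congr rfl fun k _ => ?_
  have h := measurePreserving_past c μ π k
  have hi := integrable_epochGain c μ π hc hΘ hμΘ (k : ℕ)
  rw [← h.map_eq] at hi ⊢
  exact integral_map h.measurable.aemeasurable hi.aestronglyMeasurable

include hc hΘ hμ hμΘ hent in
/-- The expected shortfall from the optimal entropy reduction. -/
lemma condEntropy_sub_lower_bound :
    condEntropy Θ (law c μ π K) - (diffEntropy Θ μ - K * c.capacity) =
      ∫ ω, ∑ k : Fin K, (c.capacity - c.phi (askedPredictive c Θ μ π ω.2 k)) ∂(law c μ π K) := by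
  have h := diffEntropy_sub_condEntropy c μ π (K := K) hc hΘ hμ hμΘ hent
  simp_rw [Finset.sum_sub_distrib]
  rw [integral_sub (integrable_const _)
    (integrable_finsetSum _ fun k _ => integrable_phi_askedPredictive c μ π hc hΘ hμΘ k), ← h]
  simp
  ring

include hc hΘ hμΘ in
lemma shortfall_nonneg : ∀ᵐ ω ∂(law c μ π K), ∀ k : Fin K,
    0 ≤ c.capacity - c.phi (askedPredictive c Θ μ π ω.2 k) := by
  filter_upwards [ae_askedPredictive_mem_stdSimplex c μ π hΘ hμΘ] with ω hω k
  exact sub_nonneg.2 (c.phi_le_capacity hc (hω k))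

include hc hΘ hμ hμΘ hent in
lemma lower_bound_le_condEntropy :
    diffEntropy Θ μ - K * c.capacity ≤ condEntropy Θ (law c μ π K) := by
  rw [← sub_nonneg, condEntropy_sub_lower_bound c μ π hc hΘ hμ hμΘ hent]
  refine integral_nonneg_of_ae ?_
  filter_upwards [shortfall_nonneg c μ π hc hΘ hμΘ] with ω hω
  exact Finset.sum_nonneg fun k _ => hω k

include hc hΘ hμ hμΘ hent in
-- An integral of a nonnegative function is zero only if the function vanishes almost everywhere,
-- and a sum of nonnegative shortfalls only if each is zero.
lemma condEntropy_eq_lower_bound_iff :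
    condEntropy Θ (law c μ π K) = diffEntropy Θ μ - K * c.capacity ↔
      ∀ᵐ ω ∂(law c μ π K), ∀ k : Fin K,
        c.CapacityAchieving (askedPredictive c Θ μ π ω.2 k) := by
  have hn := shortfall_nonneg c μ π (K := K) hc hΘ hμΘ
  rw [← sub_eq_zero, condEntropy_sub_lower_bound c μ π hc hΘ hμ hμΘ hent,
    integral_eq_zero_iff_of_nonneg_ae
      (hn.mono fun ω hω => Finset.sum_nonneg fun k _ => hω k)
      (integrable_finsetSum _ fun k _ => (integrable_const _).sub
        (integrable_phi_askedPredictive c μ π hc hΘ hμΘ k))]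
  refine Filter.eventually_congr ?_
  filter_upwards [hn, ae_askedPredictive_mem_stdSimplex c μ π hΘ hμΘ] with ω hω hs
  rw [Pi.zero_apply, Finset.sum_eq_zero_iff_of_nonneg fun k _ => hω k]
  refine ⟨fun h k => ⟨hs k, (sub_eq_zero.1 (h k (Finset.mem_univ k))).symm⟩, fun h k _ => ?_⟩
  rw [(h k).2, sub_self]

include hc hΘ hμ hμΘ hent in
/-- Under almost every belief, the information gain of each question is `φ` of its predictive
distribution. -/
lemma ae_mutualInfo_belief_eq_phi (k : ℕ) : ∀ᵐ h ∂(historyLaw c μ π k), ∀ X : Question S m,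
    mutualInfo c Θ (belief c μ π k h) X = c.phi (predictive Θ (belief c μ π k h) X) := by
  obtain ⟨ℓ, hℓ⟩ := exists_hasLogDensity c μ π hμ hent k
  -- The exceptional null set concerns the belief alone and is fixed before `X`; this matters
  -- because entropy pursuit compares possibly uncountably many questions.
  filter_upwards [hℓ.ac, hℓ.eq, hℓ.ae_integrable, ae_ae_belief_mem c μ π hΘ hμΘ k]
    with h h1 h2 h3 h4 X
  exact mutualInfo_eq_phi c hc hΘ h1 h4 (h3.congr (h2.mono fun _ hθ => hθ.symm)) X

include hc hΘ hμ hμΘ hent in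
/-- Entropy pursuit poses capacity-achieving questions whenever there are any. -/
lemma EntropyPursuit.capacityAchieving (hπ : EntropyPursuit c Θ μ π K)
    (hX : ∀ᵐ ω ∂(law c μ π K), ∀ k : Fin K, ∃ X : Question S m,
      c.CapacityAchieving (predictive Θ (belief c μ π k (past ω.2 k)) X)) :
    ∀ᵐ ω ∂(law c μ π K), ∀ k : Fin K,
      c.CapacityAchieving (askedPredictive c Θ μ π ω.2 k) := by
  have hI : ∀ᵐ ω ∂(law c μ π K), ∀ k : Fin K, ∀ X : Question S m,
      mutualInfo c Θ (belief c μ π k (past ω.2 k)) X =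
        c.phi (predictive Θ (belief c μ π k (past ω.2 k)) X) :=
    ae_all_iff.2 fun k => ((measurePreserving_fst_questionLaw c μ π k).comp
      (measurePreserving_past c μ π k)).quasiMeasurePreserving.ae
        (ae_mutualInfo_belief_eq_phi c μ π hc hΘ hμ hμΘ hent k)
  filter_upwards [hπ, hX, hI, ae_askedPredictive_mem_stdSimplex c μ π hΘ hμΘ] with ω h1 h2 h3 h4 k
  obtain ⟨X, hX⟩ := h2 k
  refine ⟨h4 k, le_antisymm (c.phi_le_capacity hc (h4 k)) ?_⟩
  -- The posed question gains at least as much as the capacity-achieving `X`, so its `φ` is at least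
  -- the capacity.
  have h5 := h1 k X
  rw [h3, h3, hX.2] at h5
  exact h5

end Optimality

end Preference

end

open Preference
theorem mainTheorem1 {d m : ℕ} [NeZero m]
    (S : Set (Vec d)) (hS : S.Nonempty)
    (Θ : Set (Vec d)) (hΘ : MeasurableSet Θ)
    {Y : Type*} [MeasurableSpace Y] (ν : Measure Y) [SigmaFinite ν]
    (c : NoiseChannel m ν)
    (hc : ∀ z, Integrable (fun y => c.f z y * Real.logb 2 (c.f z y)) ν)
    (μ : Measure (Vec d)) [IsProbabilityMeasure μ]
    (hμ : μ ≪ volume) (hμΘ : ∀ᵐ θ ∂μ, θ ∈ Θ)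
    (hent : Integrable (fun θ => lebesgueDensity μ θ * Real.logb 2 (lebesgueDensity μ θ))
      (volume.restrict Θ)) :
    -- the capacity is a maximum
    IsGreatest (c.phi '' stdSimplex ℝ (Fin m)) c.capacity ∧
    ∀ K : ℕ,
      -- the entropy reduction under any policy
      (∀ π : Policy S m Y,
        Integrable (posteriorEntropy Θ (law c μ π K)) ((law c μ π K).map Prod.snd) ∧
        Integrable (fun ω => ∑ k : Fin K, c.phi (askedPredictive c Θ μ π ω.2 k)) (law c μ π K) ∧
        diffEntropy Θ μ - condEntropy Θ (law c μ π K) =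
          ∫ ω, ∑ k : Fin K, c.phi (askedPredictive c Θ μ π ω.2 k) ∂(law c μ π K)) ∧
      -- the lower bound
      (∀ π : Policy S m Y,
        diffEntropy Θ μ - K * c.capacity ≤ condEntropy Θ (law c μ π K)) ∧
      diffEntropy Θ μ - K * c.capacity ≤ ⨅ π : Policy S m Y, condEntropy Θ (law c μ π K) ∧
      -- when the lower bound is attained
      (∀ π : Policy S m Y,
        condEntropy Θ (law c μ π K) = diffEntropy Θ μ - K * c.capacity ↔
          ∀ᵐ ω ∂(law c μ π K), ∀ k : Fin K,
            c.CapacityAchieving (askedPredictive c Θ μ π ω.2 k)) ∧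
      (∀ u : Fin m → ℝ, (∀ v, c.CapacityAchieving v ↔ v = u) → ∀ π : Policy S m Y,
        (condEntropy Θ (law c μ π K) = diffEntropy Θ μ - K * c.capacity ↔
          ∀ᵐ ω ∂(law c μ π K), ∀ k : Fin K, askedPredictive c Θ μ π ω.2 k = u)) ∧
      -- optimality of entropy pursuit
      (∀ π : Policy S m Y, EntropyPursuit c Θ μ π K →
        (∀ᵐ ω ∂(law c μ π K), ∀ k : Fin K, ∃ X : Question S m,
          c.CapacityAchieving (predictive Θ (belief c μ π k (past ω.2 k)) X)) →
        condEntropy Θ (law c μ π K) = diffEntropy Θ μ - K * c.capacity ∧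
        ∀ π' : Policy S m Y, condEntropy Θ (law c μ π K) ≤ condEntropy Θ (law c μ π' K)) := by
  have hlog := integrable_logb_lebesgueDensity hμ hΘ hμΘ hent
  have hne : Nonempty (Policy S m Y) := nonempty_policy hS
  have hlow := fun (K : ℕ) (π : Policy S m Y) =>
    lower_bound_le_condEntropy c μ π (K := K) hc hΘ hμ hμΘ hlog
  have hiff := fun (K : ℕ) (π : Policy S m Y) =>
    condEntropy_eq_lower_bound_iff c μ π (K := K) hc hΘ hμ hμΘ hlog
  refine ⟨c.isGreatest_capacity hc, fun K => ⟨fun π => ⟨?_, ?_, ?_⟩, hlow K,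
    le_ciInf (hlow K), hiff K, fun u hu π => ?_, fun π hπ hX => ?_⟩⟩
  · exact integrable_posteriorEntropy c μ π hΘ hμ hμΘ hlog K
  · exact integrable_finsetSum _ fun k _ => integrable_phi_askedPredictive c μ π hc hΘ hμΘ k
  · exact diffEntropy_sub_condEntropy c μ π hc hΘ hμ hμΘ hlog
  · simp only [hiff K π, hu]
  · have h := (hiff K π).2 (hπ.capacityAchieving c μ π hc hΘ hμ hμΘ hlog hX)
    exact ⟨h, fun π' => h.trans_le (hlow K π')⟩
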